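/- Let $K\ge 1$ and let $\alpha=(\alpha_i)_{1\le i\le K}$, $\beta$, $\gamma=(\gamma_i)_{1\le i\le K}$ be nonnegative, bounded, continuous functions on $[0,\infty)$ (rate functions). Let $\mathcal W=\mathcal D([0,\infty):\mathbb N_0)$ be the Skorohod space of right continuous functions with left limits, and $\mathcal X=[0,\infty)\times\mathcal W$. For $s\ge 0$ and $1\le i\le K$ let $\nu_{s,i}$ be the law on $\mathcal W$ of the process $w$ with $w(r)=0$ for $r<s$ which on $[s,\infty)$ is the pure jump Markov process that starts in the state $w(s)=K+i$ at time $s$ and, at time $u>s$ and in state $k$, has jumps of size $j$ at rate $k\gamma_j(u)$, $1\le j\le K$; that is, its generator is $(\mathcal A(u)f)(k)=\sum_{j=1}^K k\gamma_j(u)\,(f(k+j)-f(k))$. For $t\ge 0$ define the measure $\mu_t$ on $\mathcal X$ and the kernel $\kappa_t$ on $\mathcal X\times\mathcal X$ by $$\int_{\mathcal X} f\,d\mu_t=\sum_{i=1}^K\int_0^t\alpha_i(u)\Big(\int_{\mathcal W}f(u,w)\,\nu_{u,i}(dw)\Big)du,\qquad \kappa_t((s,w),(r,\tilde w))=\int_0^t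 w(u)\tilde w(u)\beta(u)\,du ,$$ and let $\rho(t)=\rho_t(\alpha,\beta,\gamma)$ be the norm of the integral operator $\mathcal K_tf(x)=\int_{\mathcal X}\kappa_t(x,y)f(y)\,\mu_t(dy)$ on $L^2(\mathcal X,\mu_t)$, i.e. $\rho(t)=\sup_{f\in L^2(\mu_t),\,f\ne 0}\|\mathcal K_tf\|_2/\|f\|_2$ (and $\rho(t)=0$ if $\mu_t=0$). Suppose that $\beta(t)>0$ for all $t>0$, that $\liminf_{t\to\infty}\beta(t)>0$, and that for no $t>0$ all of the functions $\alpha_1,\dots,\alpha_K$ vanish identically on $[0,t]$. Then: (i) $\rho(t)<\infty$ for all $t\ge 0$, and $\rho$ is a continuous, strictly increasing function on $[0,\infty)$ with $\rho(0)=0$ and $\lim_{t\to\infty}\rho(t)=\infty$. (ii) There is a unique $t_c'=t_c'(\alpha,\beta,\gamma)\in[0,\infty)$ such that $\rho(t_c')=1$. -/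

import Mathlib

open MeasureTheory ProbabilityTheory Set Filter Topology
open scoped NNReal ENNReal

namespace IRG

noncomputable section

/-- Lebesgue measure on `[0, ∞)`. -/
def leb : Measure ℝ≥0 := (volume : Measure ℝ).comap ((↑) : ℝ≥0 → ℝ)

/-- A function `[0, ∞) → ℕ` that is right continuous and has left limits. -/
def IsCadlag (w : ℝ≥0 → ℕ) : Prop :=
  (∀ t, ContinuousWithinAt w (Ici t) t) ∧ ∀ t, ∃ l, Tendsto w (𝓝[<] t) (𝓝 l)

/-- The space `D([0, ∞) : ℕ)`. As a subtype of a product it carries the `σ`-field generated by the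
coordinate maps, which is the Borel `σ`-field of the Skorohod topology. -/
abbrev PathSpace : Type := {w : ℝ≥0 → ℕ // IsCadlag w}

/-- Rate functions `(α, β, γ)`: nonnegative, bounded, continuous functions on `[0, ∞)`. The index
`i : Fin K` stands for the index `i + 1` in `{1, …, K}`. -/
structure RateFunctions (K : ℕ) where
  α : Fin K → ℝ≥0 → ℝ≥0
  β : ℝ≥0 → ℝ≥0
  γ : Fin K → ℝ≥0 → ℝ≥0
  continuous_α : ∀ i, Continuous (α i)
  continuous_β : Continuous β
  continuous_γ : ∀ i, Continuous (γ i)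
  bdd_α : ∀ i, BddAbove (range (α i))
  bdd_β : BddAbove (range β)
  bdd_γ : ∀ i, BddAbove (range (γ i))

/-! ### The pure jump process

The process with generator `(𝒜(u) f)(k) = ∑ j, k γ_j(u) (f (k + j) - f k)` is constructed from
independent standard exponential variables. When it has entered state `k` at time `u`, `K` fresh
clocks are started; clock `j` has hazard rate `k γ_j`, that is, it rings at the first time `r ≥ u`
at which `k ∫_u^r γ_j` reaches the `j`-th exponential variable. At the first ring the process jumps
by the label of the clock that rang. -/

/-- The time at which a clock with hazard rate `k g`, started at time `u`, rings, when its
exponential variable has the value `e`. It is `∞` if the clock never rings. -/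
def ringTime (g : ℝ≥0 → ℝ≥0) (k : ℕ) (u : ℝ≥0∞) (e : ℝ) : ℝ≥0∞ :=
  ⨅ (r : ℝ≥0) (_ : u ≤ r ∧
    ENNReal.ofReal e ≤ k * ∫⁻ x in {x : ℝ≥0 | u ≤ x ∧ x ≤ r}, (g x : ℝ≥0∞) ∂leb), (r : ℝ≥0∞)

/-- From (time of the last jump, current state) to (time of the next jump, next state).
Clock `j : Fin K` causes a jump of size `j + 1`; ties have probability zero. -/
def step {K : ℕ} (γ : Fin K → ℝ≥0 → ℝ≥0) (e : Fin K → ℝ) (p : ℝ≥0∞ × ℕ) : ℝ≥0∞ × ℕ :=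
  (⨅ j, ringTime (γ j) p.2 p.1 (e j),
    p.2 + sInf {m : ℕ | ∃ j : Fin K,
      ringTime (γ j) p.2 p.1 (e j) = ⨅ l, ringTime (γ l) p.2 p.1 (e l) ∧ m = j + 1})

/-- The sequence of (jump time, state entered), started in state `k` at time `s`. -/
def jumpChain {K : ℕ} (γ : Fin K → ℝ≥0 → ℝ≥0) (k : ℕ) (s : ℝ≥0) (ω : ℕ × Fin K → ℝ) :
    ℕ → ℝ≥0∞ × ℕ
  | 0 => (s, k)
  | n + 1 => step γ (fun j => ω (n, j)) (jumpChain γ k s ω n)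

/-- No explosion: every time is eventually exceeded by the jump times. -/
def NoExplosion {K : ℕ} (γ : Fin K → ℝ≥0 → ℝ≥0) (k : ℕ) (s : ℝ≥0) (ω : ℕ × Fin K → ℝ) : Prop :=
  ∀ r : ℝ≥0, ∃ n, (r : ℝ≥0∞) < (jumpChain γ k s ω n).1

open Classical in
/-- The path: `0` before time `s`, and from then on the state entered at the last jump time.
(`sInf {n | r < T (n + 1)}` is the number of jumps up to time `r`.) On the event of an explosion,
which has probability zero for bounded rates, the path is taken constant on `[s, ∞)`. -/
def pathFun {K : ℕ} (γ : Fin K → ℝ≥0 → ℝ≥0) (k : ℕ) (s : ℝ≥0) (ω : ℕ × Fin K → ℝ) (r : ℝ≥0) : ℕ :=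
  if r < s then 0
  else if NoExplosion γ k s ω then
    (jumpChain γ k s ω (sInf {n | (r : ℝ≥0∞) < (jumpChain γ k s ω (n + 1)).1})).2
  else k

lemma jumpChain_fst_mono {K : ℕ} (γ : Fin K → ℝ≥0 → ℝ≥0) (k : ℕ) (s : ℝ≥0)
    (ω : ℕ × Fin K → ℝ) : Monotone fun n => (jumpChain γ k s ω n).1 := by
  refine monotone_nat_of_le_succ fun n => ?_
  simp only [jumpChain, step, ringTime, le_iInf_iff]
  exact fun _ _ h => h.1

lemma jumpChain_snd_mono {K : ℕ} (γ : Fin K → ℝ≥0 → ℝ≥0) (k : ℕ) (s : ℝ≥0)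
    (ω : ℕ × Fin K → ℝ) : Monotone fun n => (jumpChain γ k s ω n).2 := by
  refine monotone_nat_of_le_succ fun n => ?_
  simp only [jumpChain, step]
  omega

lemma NoExplosion.exists_succ {K : ℕ} {γ : Fin K → ℝ≥0 → ℝ≥0} {k : ℕ} {s : ℝ≥0}
    {ω : ℕ × Fin K → ℝ} (h : NoExplosion γ k s ω) (r : ℝ≥0) :
    ∃ n, (r : ℝ≥0∞) < (jumpChain γ k s ω (n + 1)).1 := by
  obtain ⟨n, hn⟩ := h r
  exact ⟨n, hn.trans_le (jumpChain_fst_mono γ k s ω n.le_succ)⟩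

lemma pathFun_mono {K : ℕ} (γ : Fin K → ℝ≥0 → ℝ≥0) (k : ℕ) (s : ℝ≥0) (ω : ℕ × Fin K → ℝ) :
    Monotone (pathFun γ k s ω) := by
  intro r r' hr
  by_cases h1 : r < s
  · simp [pathFun, h1]
  have h1' : ¬ r' < s := fun h => h1 (hr.trans_lt h)
  by_cases h2 : NoExplosion γ k s ω
  · simp only [pathFun, h1, h1', h2, if_true, if_false]
    refine jumpChain_snd_mono γ k s ω ?_
    have hm : (r' : ℝ≥0∞) < _ := Nat.sInf_mem (h2.exists_succ r')
    exact Nat.sInf_le (show (r : ℝ≥0∞) < _ from lt_of_le_of_lt (by exact_mod_cast hr) hm)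
  · simp [pathFun, h1, h1', h2]

lemma isCadlag_pathFun {K : ℕ} (γ : Fin K → ℝ≥0 → ℝ≥0) (k : ℕ) (s : ℝ≥0) (ω : ℕ × Fin K → ℝ) :
    IsCadlag (pathFun γ k s ω) := by
  refine ⟨fun r => ?_, fun r => ?_⟩
  · suffices h : ∀ᶠ r' in 𝓝[≥] r, pathFun γ k s ω r' = pathFun γ k s ω r from
      tendsto_nhds_of_eventually_eq h
    by_cases h1 : r < s
    · filter_upwards [mem_nhdsWithin_of_mem_nhds (Iio_mem_nhds h1)] with r' hr'
      simp [pathFun, h1, mem_Iio.1 hr']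
    by_cases h2 : NoExplosion γ k s ω
    · set n := sInf {n | (r : ℝ≥0∞) < (jumpChain γ k s ω (n + 1)).1} with hn
      have hlt : (r : ℝ≥0∞) < (jumpChain γ k s ω (n + 1)).1 := Nat.sInf_mem (h2.exists_succ r)
      have hopen : {r' : ℝ≥0 | (r' : ℝ≥0∞) < (jumpChain γ k s ω (n + 1)).1} ∈ 𝓝 r :=
        (isOpen_lt ENNReal.continuous_coe continuous_const).mem_nhds hlt
      filter_upwards [mem_nhdsWithin_of_mem_nhds hopen, self_mem_nhdsWithin] with r' hr' hle
      have hle : r ≤ r' := hle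
      have h1' : ¬ r' < s := fun h => h1 (hle.trans_lt h)
      have hn' : sInf {n | (r' : ℝ≥0∞) < (jumpChain γ k s ω (n + 1)).1} = n := by
        refine le_antisymm (Nat.sInf_le hr') ?_
        have hm : (r' : ℝ≥0∞) < _ := Nat.sInf_mem (h2.exists_succ r')
        exact Nat.sInf_le (show (r : ℝ≥0∞) < _ from lt_of_le_of_lt (by exact_mod_cast hle) hm)
      simp only [pathFun, h1, h1', h2, if_true, if_false, hn', ← hn]
    · filter_upwards [self_mem_nhdsWithin] with r' hle
      have h1' : ¬ r' < s := fun h => h1 (lt_of_le_of_lt hle h)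
      simp [pathFun, h1, h1', h2]
  · refine ⟨_, (pathFun_mono γ k s ω).tendsto_nhdsLT r⟩

/-- The random path of the process started in state `k` at time `s`. -/
def path {K : ℕ} (γ : Fin K → ℝ≥0 → ℝ≥0) (k : ℕ) (s : ℝ≥0) (ω : ℕ × Fin K → ℝ) : PathSpace :=
  ⟨pathFun γ k s ω, isCadlag_pathFun γ k s ω⟩

lemma measurable_natSInf {X : Type*} [MeasurableSpace X] {P : X → ℕ → Prop}
    (hP : ∀ m, MeasurableSet {x | P x m}) : Measurable fun x => sInf {m | P x m} := by
  refine measurable_to_countable' fun n => ?_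
  have h : (fun x => sInf {m | P x m}) ⁻¹' {n} =
      ({x | P x n} ∩ ⋂ m ∈ Iio n, {x | P x m}ᶜ) ∪ ({_x | n = 0} ∩ ⋂ m, {x | P x m}ᶜ) := by
    ext x
    simp only [mem_preimage, mem_singleton_iff, mem_union, mem_inter_iff, mem_ofPred_eq, mem_iInter,
      mem_compl_iff, mem_Iio]
    constructor
    · rintro rfl
      by_cases hne : {m | P x m}.Nonempty
      · exact Or.inl ⟨Nat.sInf_mem hne, fun m hm => Nat.notMem_of_lt_sInf hm⟩
      · rw [not_nonempty_iff_eq_empty] at hne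
        exact Or.inr ⟨by simp [hne], fun m hm => by
          have : m ∈ {m | P x m} := hm
          simp [hne] at this⟩
    · rintro (⟨h1, h2⟩ | ⟨h1, h2⟩)
      · refine le_antisymm (Nat.sInf_le h1) ?_
        by_contra! hlt
        exact h2 _ hlt (Nat.sInf_mem (s := {m | P x m}) ⟨n, h1⟩)
      · have : {m | P x m} = ∅ := by ext m; simpa using h2 m
        simp [this, h1]
  rw [h]
  exact ((hP n).inter (.biInter (to_countable _) fun m _ => (hP m).compl)).union
    ((MeasurableSet.const _).inter (.iInter fun m => (hP m).compl))

lemma measurable_ringTime (g : ℝ≥0 → ℝ≥0) :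
    Measurable fun q : (ℝ≥0∞ × ℕ) × ℝ => ringTime g q.1.2 q.1.1 q.2 := by
  refine measurable_of_Iio fun a => ?_
  have h : (fun q : (ℝ≥0∞ × ℕ) × ℝ => ringTime g q.1.2 q.1.1 q.2) ⁻¹' Iio a =
      ⋃ r : ℚ, {q | (((Real.toNNReal r : ℝ≥0) : ℝ≥0∞) < a ∧
          q.1.1 ≤ ((Real.toNNReal r : ℝ≥0) : ℝ≥0∞)) ∧
        ENNReal.ofReal q.2 ≤ q.1.2 * ∫⁻ x in {x : ℝ≥0 | q.1.1 ≤ (x : ℝ≥0∞) ∧ x ≤ Real.toNNReal r},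
          (g x : ℝ≥0∞) ∂leb} := by
    ext q
    simp only [ringTime, mem_preimage, mem_Iio, iInf_lt_iff, mem_iUnion, mem_ofPred_eq]
    constructor
    · rintro ⟨r, ⟨h1, h2⟩, h3⟩
      obtain ⟨c, -, hc1, hc2⟩ := ENNReal.lt_iff_exists_rat_btwn.1 h3
      have hrc : r ≤ Real.toNNReal c := by exact_mod_cast hc1.le
      refine ⟨c, ⟨hc2, h1.trans hc1.le⟩, h2.trans ?_⟩
      gcongr
    · rintro ⟨r, ⟨h1, h2⟩, h3⟩
      exact ⟨_, ⟨h2, h3⟩, h1⟩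
  rw [h]
  refine .iUnion fun r => ?_
  have hmono : Antitone fun u : ℝ≥0∞ =>
      ∫⁻ x in {x : ℝ≥0 | u ≤ (x : ℝ≥0∞) ∧ x ≤ Real.toNNReal r}, (g x : ℝ≥0∞) ∂leb := fun u v huv =>
    lintegral_mono_set fun x hx => ⟨huv.trans hx.1, hx.2⟩
  have hI := hmono.measurable.comp
    (measurable_fst.comp (measurable_fst : Measurable fun q : (ℝ≥0∞ × ℕ) × ℝ => q.1))
  have hk : Measurable fun q : (ℝ≥0∞ × ℕ) × ℝ => (q.1.2 : ℝ≥0∞) :=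
    (measurable_of_countable (fun n : ℕ => (n : ℝ≥0∞))).comp measurable_fst.snd
  exact ((MeasurableSet.const _).inter (measurableSet_le measurable_fst.fst measurable_const)).inter
    (measurableSet_le (ENNReal.measurable_ofReal.comp measurable_snd) (hk.mul hI))

lemma measurable_jumpChain {K : ℕ} (γ : Fin K → ℝ≥0 → ℝ≥0) (k n : ℕ) :
    Measurable fun q : ℝ≥0 × (ℕ × Fin K → ℝ) => jumpChain γ k q.1 q.2 n := by
  induction n with
  | zero => simp only [jumpChain]; fun_prop
  | succ n ih =>
    have hT : ∀ j, Measurable fun q : ℝ≥0 × (ℕ × Fin K → ℝ) =>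
        ringTime (γ j) (jumpChain γ k q.1 q.2 n).2 (jumpChain γ k q.1 q.2 n).1 (q.2 (n, j)) :=
      fun j => (measurable_ringTime (γ j)).comp (ih.prodMk (by fun_prop))
    simp only [jumpChain, step]
    refine (Measurable.iInf hT).prodMk (ih.snd.add (measurable_natSInf fun m => ?_))
    simp only [ofPred_exists]
    exact .iUnion fun j => (measurableSet_eq_fun (hT j) (Measurable.iInf hT)).inter
      (MeasurableSet.const _)

lemma measurable_path {K : ℕ} (γ : Fin K → ℝ≥0 → ℝ≥0) (k : ℕ) :
    Measurable fun q : ℝ≥0 × (ℕ × Fin K → ℝ) => path γ k q.1 q.2 := by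
  refine Measurable.subtype_mk (measurable_pi_iff.2 fun r => ?_)
  have hexp : {q : ℝ≥0 × (ℕ × Fin K → ℝ) | NoExplosion γ k q.1 q.2} =
      ⋂ m : ℕ, ⋃ n, {q | ((m : ℝ≥0) : ℝ≥0∞) < (jumpChain γ k q.1 q.2 n).1} := by
    ext q
    simp only [NoExplosion, mem_ofPred_eq, mem_iInter, mem_iUnion]
    refine ⟨fun h m => h m, fun h r => ?_⟩
    obtain ⟨m, hm⟩ := exists_nat_ge r
    obtain ⟨n, hn⟩ := h m
    exact ⟨n, lt_of_le_of_lt (by exact_mod_cast hm) hn⟩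
  have hexp' : MeasurableSet {q : ℝ≥0 × (ℕ × Fin K → ℝ) | NoExplosion γ k q.1 q.2} := by
    rw [hexp]
    exact .iInter fun m => .iUnion fun n =>
      measurableSet_lt measurable_const (measurable_jumpChain γ k n).fst
  have hN : Measurable fun q : ℝ≥0 × (ℕ × Fin K → ℝ) =>
      sInf {n | (r : ℝ≥0∞) < (jumpChain γ k q.1 q.2 (n + 1)).1} :=
    measurable_natSInf fun n =>
      measurableSet_lt measurable_const (measurable_jumpChain γ k (n + 1)).fst
  have hZ : Measurable fun p : (ℝ≥0 × (ℕ × Fin K → ℝ)) × ℕ =>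
      (jumpChain γ k p.1.1 p.1.2 p.2).2 :=
    measurable_from_prod_countable_left fun n => (measurable_jumpChain γ k n).snd
  unfold pathFun
  refine Measurable.ite (measurableSet_lt measurable_const measurable_fst) measurable_const ?_
  exact Measurable.ite hexp' (hZ.comp (measurable_id.prodMk hN)) measurable_const

/-! ### Type measure, kernel and operator norm -/

/-- The law of a family of independent standard exponential random variables. -/
def clockLaw (K : ℕ) : Measure (ℕ × Fin K → ℝ) := Measure.infinitePi fun _ => expMeasure 1

instance (K : ℕ) : IsProbabilityMeasure (clockLaw K) := by
  have := isProbabilityMeasure_expMeasure one_pos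
  unfold clockLaw
  infer_instance

/-- The laws `ν_{s,i}`, as a kernel in `s`: the law on path space of the pure jump process started
at time `s` in the state `K + (i + 1)`, extended by `0` before time `s`. -/
def pathLaw {K : ℕ} (γ : Fin K → ℝ≥0 → ℝ≥0) (i : Fin K) : Kernel ℝ≥0 PathSpace where
  toFun s := (clockLaw K).map (path γ (K + (i + 1)) s)
  measurable' := by
    refine Measure.measurable_of_measurable_coe _ fun A hA => ?_
    have hp := measurable_path γ (K + (i + 1))
    have h : ∀ s, (clockLaw K).map (path γ (K + (i + 1)) s) A =
        clockLaw K (Prod.mk s ⁻¹' ((fun q : ℝ≥0 × (ℕ × Fin K → ℝ) =>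
          path γ (K + (i + 1)) q.1 q.2) ⁻¹' A)) := fun s => by
      have hs : Measurable (path γ (K + (i + 1)) s) := hp.comp measurable_prodMk_left
      rw [Measure.map_apply hs hA]
      rfl
    simp only [h]
    exact measurable_measure_prodMk_left (hp hA)

/-- The type space `[0, ∞) × D([0, ∞) : ℕ)`. -/
abbrev TypeSpace : Type := ℝ≥0 × PathSpace

/-- The type measure
`μ_t(du, dw) = ∑ i, 1_{[0,t]}(u) α_i(u) ν_{u,i}(dw) du`. -/
def typeMeasure {K : ℕ} (R : RateFunctions K) (t : ℝ≥0) : Measure TypeSpace :=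
  ∑ i, ((leb.restrict (Iic t)).withDensity fun u => (R.α i u : ℝ≥0∞)) ⊗ₘ pathLaw R.γ i

/-- The kernel `κ_t((s, w), (r, w')) = ∫_0^t w(u) w'(u) β(u) du`. -/
def typeKernel {K : ℕ} (R : RateFunctions K) (t : ℝ≥0) (x y : TypeSpace) : ℝ :=
  ∫ u in Iic t, (x.2.1 u : ℝ) * (y.2.1 u : ℝ) * (R.β u : ℝ) ∂leb

/-- The integral operator associated with `(κ, μ)`. -/
def integralOp {X : Type*} [MeasurableSpace X] (μ : Measure X) (κ : X → X → ℝ) (f : X → ℝ) (x : X) :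
    ℝ :=
  ∫ y, κ x y * f y ∂μ

/-- The norm of the integral operator on `L²(μ)`: the supremum of `‖𝒦 f‖₂ / ‖f‖₂` over the
`f ∈ L²(μ)` with `f ≠ 0`, as an extended nonnegative number. -/
def integralOpNorm {X : Type*} [MeasurableSpace X] (μ : Measure X) (κ : X → X → ℝ) : ℝ≥0∞ :=
  ⨆ (f : X → ℝ) (_ : MemLp f 2 μ ∧ eLpNorm f 2 μ ≠ 0),
    eLpNorm (integralOp μ κ f) 2 μ / eLpNorm f 2 μ

/-- `ρ(t) = ρ_t(α, β, γ)`, the norm of the integral operator associated with `(κ_t, μ_t)`. -/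
def rho {K : ℕ} (R : RateFunctions K) (t : ℝ≥0) : ℝ≥0∞ :=
  integralOpNorm (typeMeasure R t) (typeKernel R t)

end

end IRG

/-!
The operator `𝒦_t` has the kernel `κ_t(x, y) = ∫_0^t w(u) w'(u) β(u) du`, so that it is `S* S` with
`S f (u) = ∫ w(u) f dμ_t`, as an operator into `L²([0, t], β du)`. As everything is nonnegative,
`ρ(t) = ‖S‖²` is the least constant `c` such that `∫_0^t (S f)² β ≤ c ∫ f²` for all nonnegative `f`
(`integralOpNorm_le_iff`). A path that starts after time `t` vanishes on `[0, t]`, so that `μ_t` may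
be replaced by a measure that does not depend on `t` (`rho_le_iff`), and only the range of the time
integral varies. The theorem then follows from two estimates.

* By Cauchy-Schwarz, `(S f (u))² ≤ ∫ w(u)² dμ · ∫ f²`. The second moment is bounded for `u` in a
  bounded interval, whence `ρ` is finite and locally Lipschitz (`exists_rho_le_add`).
* Almost every path is nondecreasing, so `S f` is nondecreasing for `f ≥ 0`, and the `β`-average of
  `(S f)²` over `[0, t]` increases with `t`. So `ρ(t) / ∫_0^t β` is nondecreasing
  (`rho_le_mul_div`). As `∫_0^t β` is strictly increasing and tends to `∞`, and `ρ(t) > 0` for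
  `t > 0`, the norm `ρ` is strictly increasing and tends to `∞`.

The only fact on the law of the jump process that takes work is the bound on the second moment
(`exists_lintegral_path_sq_le`). After `m` jumps the state is at most `k + m K`. If all clocks of a
step have exponential variables larger than `1`, an event of a fixed probability that is independent
between steps, then the step takes at least the time `1 / ((m + 1) c)`. An exponential Markov
inequality gives `P(T_n ≤ r) = O(n⁻⁴)` for the `n`-th jump time `T_n`, uniformly in the starting
time. No separate argument for the absence of explosions is needed, since a path is constant from
its starting time on in that event.
-/

namespace IRG

/-! ### The norm of a Gram operator -/

/-- Cauchy-Schwarz, squared, for integrals of extended nonnegative functions. -/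
lemma sq_lintegral_mul_le {U : Type*} [MeasurableSpace U] (ζ : Measure U) {F G : U → ℝ≥0∞}
    (hF : AEMeasurable F ζ) (hG : AEMeasurable G ζ) :
    (∫⁻ u, F u * G u ∂ζ) ^ 2 ≤ (∫⁻ u, F u ^ 2 ∂ζ) * ∫⁻ u, G u ^ 2 ∂ζ := by
  have h := ENNReal.lintegral_mul_le_Lp_mul_Lq ζ Real.HolderConjugate.two_two hF hG
  have hs : ∀ x : ℝ≥0∞, (x ^ (1 / (2 : ℝ))) ^ 2 = x := fun x => by
    rw [← ENNReal.rpow_natCast, ← ENNReal.rpow_mul]; norm_num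
  calc _ ≤ _ := pow_le_pow_left' h 2
    _ = _ := by
      rw [mul_pow, hs, hs]
      norm_cast

lemma eLpNorm_two_sq {X : Type*} [MeasurableSpace X] (μ : Measure X) (f : X → ℝ) :
    eLpNorm f 2 μ ^ 2 = ∫⁻ x, ‖f x‖ₑ ^ 2 ∂μ := by
  have h := eLpNorm_nnreal_pow_eq_lintegral (μ := μ) (f := f) (p := 2) (by norm_num)
  simp only [NNReal.coe_ofNat, ENNReal.rpow_ofNat, ENNReal.coe_ofNat] at h
  exact h

section Gram

variable {U X : Type*} [MeasurableSpace U] [MeasurableSpace X]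

/-- The transform `f ↦ (u ↦ ∫ h(u, x) f(x) μ(dx))`. -/
noncomputable def transform (μ : Measure X) (h : U → X → ℝ≥0) (f : X → ℝ≥0∞) (u : U) : ℝ≥0∞ :=
  ∫⁻ x, h u x * f x ∂μ

/-- The adjoint transform `g ↦ (x ↦ ∫ h(u, x) g(u) ζ(du))`. -/
noncomputable def adjTransform (ζ : Measure U) (h : U → X → ℝ≥0) (g : U → ℝ≥0∞) (x : X) : ℝ≥0∞ :=
  ∫⁻ u, h u x * g u ∂ζ

lemma measurable_transform {μ : Measure X} [SFinite μ] {h : U → X → ℝ≥0}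
    (hh : Measurable (Function.uncurry h)) {f : X → ℝ≥0∞} (hf : Measurable f) :
    Measurable (transform μ h f) := by
  have : Measurable fun q : U × X => (h q.1 q.2 : ℝ≥0∞) * f q.2 :=
    hh.coe_nnreal_ennreal.mul (hf.comp measurable_snd)
  exact this.lintegral_prod_right

lemma measurable_adjTransform {ζ : Measure U} [SFinite ζ] {h : U → X → ℝ≥0}
    (hh : Measurable (Function.uncurry h)) {g : U → ℝ≥0∞} (hg : Measurable g) :
    Measurable (adjTransform ζ h g) := by
  have : Measurable fun q : U × X => (h q.1 q.2 : ℝ≥0∞) * g q.1 :=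
    hh.coe_nnreal_ennreal.mul (hg.comp measurable_fst)
  exact this.lintegral_prod_left

lemma lintegral_transform_mul {ζ : Measure U} {μ : Measure X} [SFinite ζ] [SFinite μ]
    {h : U → X → ℝ≥0} (hh : Measurable (Function.uncurry h)) {f : X → ℝ≥0∞} (hf : Measurable f)
    {g : U → ℝ≥0∞} (hg : Measurable g) :
    ∫⁻ u, transform μ h f u * g u ∂ζ = ∫⁻ x, f x * adjTransform ζ h g x ∂μ := by
  have hm : Measurable fun q : U × X => (h q.1 q.2 : ℝ≥0∞) * f q.2 * g q.1 :=
    (hh.coe_nnreal_ennreal.mul (hf.comp measurable_snd)).mul (hg.comp measurable_fst)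
  have h1 : ∀ u, transform μ h f u * g u = ∫⁻ x, (h u x : ℝ≥0∞) * f x * g u ∂μ := fun u => by
    have hm1 : Measurable fun x => (h u x : ℝ≥0∞) * f x :=
      (hh.comp measurable_prodMk_left).coe_nnreal_ennreal.mul hf
    exact (lintegral_mul_const _ hm1).symm
  have h2 : ∀ x, f x * adjTransform ζ h g x = ∫⁻ u, (h u x : ℝ≥0∞) * f x * g u ∂ζ := fun x => by
    have hm2 : Measurable fun u => (h u x : ℝ≥0∞) * g u :=
      (hh.comp measurable_prodMk_right).coe_nnreal_ennreal.mul hg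
    rw [adjTransform, ← lintegral_const_mul _ hm2]
    exact lintegral_congr fun u => by ring
  simp only [h1, h2]
  exact lintegral_lintegral_swap hm.aemeasurable

lemma adjTransform_transform {ζ : Measure U} {μ : Measure X} [SFinite ζ] [SFinite μ]
    {h : U → X → ℝ≥0} (hh : Measurable (Function.uncurry h)) {f : X → ℝ≥0∞} (hf : Measurable f)
    (x : X) :
    adjTransform ζ h (transform μ h f) x
      = ∫⁻ y, (∫⁻ u, (h u x : ℝ≥0∞) * h u y ∂ζ) * f y ∂μ := by
  have h1 : ∀ y, (∫⁻ u, (h u x : ℝ≥0∞) * h u y ∂ζ) =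
      adjTransform ζ h (fun u => (h u x : ℝ≥0∞)) y := fun y =>
    lintegral_congr fun u => mul_comm _ _
  have hx : Measurable fun u => (h u x : ℝ≥0∞) :=
    (hh.comp measurable_prodMk_right).coe_nnreal_ennreal
  simp only [h1, mul_comm _ (f _)]
  rw [← lintegral_transform_mul hh hf hx]
  exact lintegral_congr fun u => mul_comm _ _

/-- Square integrability of `h` makes the Gram operator map `L²` into `L²`. -/
lemma lintegral_sq_adjTransform_ne_top {ζ : Measure U} {μ : Measure X} [SFinite ζ]
    [SFinite μ] {h : U → X → ℝ≥0} (hh : Measurable (Function.uncurry h))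
    (hfin : ∫⁻ u, ∫⁻ x, (h u x : ℝ≥0∞) ^ 2 ∂μ ∂ζ ≠ ∞) {f : X → ℝ≥0∞} (hf : Measurable f)
    (hf2 : ∫⁻ x, f x ^ 2 ∂μ ≠ ∞) :
    ∫⁻ x, adjTransform ζ h (transform μ h f) x ^ 2 ∂μ ≠ ∞ := by
  have hT := measurable_transform (μ := μ) hh hf
  have hx : ∀ x, Measurable fun u => (h u x : ℝ≥0∞) := fun x =>
    (hh.comp measurable_prodMk_right).coe_nnreal_ennreal
  have hu : ∀ u, Measurable fun x => (h u x : ℝ≥0∞) := fun u =>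
    (hh.comp measurable_prodMk_left).coe_nnreal_ennreal
  have hh2 : Measurable fun q : U × X => (h q.1 q.2 : ℝ≥0∞) ^ 2 :=
    hh.coe_nnreal_ennreal.pow_const 2
  have hQ : ∫⁻ u, transform μ h f u ^ 2 ∂ζ ≤
      (∫⁻ u, ∫⁻ x, (h u x : ℝ≥0∞) ^ 2 ∂μ ∂ζ) * ∫⁻ x, f x ^ 2 ∂μ := by
    rw [← lintegral_mul_const _ hh2.lintegral_prod_right]
    exact lintegral_mono fun u => sq_lintegral_mul_le μ (hu u).aemeasurable hf.aemeasurable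
  have hA : ∫⁻ x, adjTransform ζ h (transform μ h f) x ^ 2 ∂μ ≤
      (∫⁻ u, ∫⁻ x, (h u x : ℝ≥0∞) ^ 2 ∂μ ∂ζ) * ∫⁻ u, transform μ h f u ^ 2 ∂ζ := by
    rw [lintegral_lintegral_swap hh2.aemeasurable, ← lintegral_mul_const _ hh2.lintegral_prod_left]
    exact lintegral_mono fun x => sq_lintegral_mul_le ζ (hx x).aemeasurable hT.aemeasurable
  exact ne_top_of_le_ne_top (ENNReal.mul_ne_top hfin
    (ne_top_of_le_ne_top (ENNReal.mul_ne_top hfin hf2) hQ)) hA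

lemma ofReal_integral_mul_eq {ζ : Measure U} {h : U → X → ℝ≥0}
    (hh : Measurable (Function.uncurry h)) {x y : X}
    (hfin : ∫⁻ u, (h u x : ℝ≥0∞) * h u y ∂ζ ≠ ∞) :
    ENNReal.ofReal (∫ u, (h u x : ℝ) * (h u y : ℝ) ∂ζ) = ∫⁻ u, (h u x : ℝ≥0∞) * h u y ∂ζ := by
  have hm : Measurable fun u => (h u x : ℝ) * (h u y : ℝ) :=
    (hh.comp measurable_prodMk_right).coe_nnreal_real.mul
      (hh.comp measurable_prodMk_right).coe_nnreal_real
  have he : ∀ u, ENNReal.ofReal ((h u x : ℝ) * (h u y : ℝ)) = (h u x : ℝ≥0∞) * h u y := fun u => by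
    rw [ENNReal.ofReal_mul (by positivity), ENNReal.ofReal_coe_nnreal, ENNReal.ofReal_coe_nnreal]
  rw [integral_eq_lintegral_of_nonneg_ae (Eventually.of_forall fun u => by positivity)
    hm.aestronglyMeasurable]
  simp only [he]
  exact ENNReal.ofReal_toReal hfin

/-- The operator with the kernel `κ(x, y) = ∫ h(u, x) h(u, y) ζ(du)` is `S* S` with
`S = transform μ h`, so that its norm is the least `c` with `‖S f‖² ≤ c ‖f‖²`; since `h ≥ 0`,
nonnegative `f` suffice. -/
theorem integralOpNorm_le_iff {ζ : Measure U} {μ : Measure X} [SFinite ζ] [SFinite μ]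
    {h : U → X → ℝ≥0} (hh : Measurable (Function.uncurry h))
    (hfin : ∫⁻ u, ∫⁻ x, (h u x : ℝ≥0∞) ^ 2 ∂μ ∂ζ ≠ ∞) (c : ℝ≥0∞) :
    integralOpNorm μ (fun x y => ∫ u, (h u x : ℝ) * (h u y : ℝ) ∂ζ) ≤ c ↔
      ∀ f : X → ℝ≥0∞, Measurable f → ∫⁻ x, f x ^ 2 ∂μ ≠ ∞ →
        ∫⁻ u, transform μ h f u ^ 2 ∂ζ ≤ c * ∫⁻ x, f x ^ 2 ∂μ := by
  have hx : ∀ x, Measurable fun u => (h u x : ℝ≥0∞) := fun x =>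
    (hh.comp measurable_prodMk_right).coe_nnreal_ennreal
  have hh2 : Measurable fun q : U × X => (h q.1 q.2 : ℝ≥0∞) ^ 2 :=
    hh.coe_nnreal_ennreal.pow_const 2
  set κ : X → X → ℝ := fun x y => ∫ u, (h u x : ℝ) * (h u y : ℝ) ∂ζ with hκ
  have hκ0 : ∀ x y, 0 ≤ κ x y := fun x y => integral_nonneg fun u => by positivity
  constructor
  · intro hc f hf hf2
    set A := adjTransform ζ h (transform μ h f) with hA
    have hAm : Measurable A := measurable_adjTransform hh (measurable_transform hh hf)
    have hA2 : ∫⁻ x, A x ^ 2 ∂μ ≠ ∞ := lintegral_sq_adjTransform_ne_top hh hfin hf hf2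
    have hQ : ∫⁻ u, transform μ h f u ^ 2 ∂ζ = ∫⁻ x, f x * A x ∂μ := by
      rw [hA, ← lintegral_transform_mul hh hf (measurable_transform hh hf)]
      exact lintegral_congr fun u => sq _
    have hftop : ∀ᵐ x ∂μ, f x < ∞ := by
      filter_upwards [ae_lt_top (hf.pow_const 2) hf2] with x hx
      exact (ENNReal.pow_lt_top_iff.1 hx).resolve_right two_ne_zero
    have hAtop : ∀ᵐ x ∂μ, A x < ∞ := by
      filter_upwards [ae_lt_top (hAm.pow_const 2) hA2] with x hx
      exact (ENNReal.pow_lt_top_iff.1 hx).resolve_right two_ne_zero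
    have hhtop : ∀ᵐ x ∂μ, ∫⁻ u, (h u x : ℝ≥0∞) ^ 2 ∂ζ < ∞ := by
      rw [lintegral_lintegral_swap hh2.aemeasurable] at hfin
      exact ae_lt_top hh2.lintegral_prod_left hfin
    have hκfin : ∀ x, ∫⁻ u, (h u x : ℝ≥0∞) ^ 2 ∂ζ < ∞ →
        ∀ᵐ y ∂μ, ENNReal.ofReal (κ x y) = ∫⁻ u, (h u x : ℝ≥0∞) * h u y ∂ζ := fun x hx' => by
      filter_upwards [hhtop] with y hy
      refine ofReal_integral_mul_eq hh fun htop => ?_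
      have := sq_lintegral_mul_le ζ (hx x).aemeasurable (hx y).aemeasurable
      rw [htop] at this
      exact absurd this (not_le.2 ((ENNReal.mul_lt_top hx' hy).trans_le (by simp)))
    set g : X → ℝ := fun x => (f x).toReal with hg
    have hgm : Measurable g := hf.ennreal_toReal
    have hgf : ∀ᵐ x ∂μ, ‖g x‖ₑ = f x := by
      filter_upwards [hftop] with x hx
      rw [hg, Real.enorm_eq_ofReal ENNReal.toReal_nonneg, ENNReal.ofReal_toReal hx.ne]
    have hg2 : eLpNorm g 2 μ ^ 2 = ∫⁻ x, f x ^ 2 ∂μ := by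
      rw [eLpNorm_two_sq]
      exact lintegral_congr_ae (hgf.mono fun x hx => by simp only [hx])
    have hgtop : eLpNorm g 2 μ ≠ ∞ := fun h' => hf2 (by rw [← hg2, h']; simp)
    -- the real integral operator agrees with the extended nonnegative one
    have hop : ∀ᵐ x ∂μ, ‖integralOp μ κ g x‖ₑ = A x := by
      filter_upwards [hAtop, hhtop] with x hxA hxh
      have hmeas : AEStronglyMeasurable (fun y => κ x y * g y) μ := by
        refine AEStronglyMeasurable.mul ?_ hgm.aestronglyMeasurable
        have : Measurable fun q : X × U => (h q.2 x : ℝ) * (h q.2 q.1 : ℝ) :=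
          ((hh.comp measurable_prodMk_right).coe_nnreal_real.comp measurable_snd).mul
            (hh.coe_nnreal_real.comp measurable_swap)
        exact (this.stronglyMeasurable.integral_prod_right (ν := ζ)).aestronglyMeasurable
      have hnn : ∀ y, 0 ≤ κ x y * g y := fun y => mul_nonneg (hκ0 x y) ENNReal.toReal_nonneg
      have hi : integralOp μ κ g x = (A x).toReal := by
        rw [integralOp, integral_eq_lintegral_of_nonneg_ae (Eventually.of_forall hnn) hmeas, hA,
          adjTransform_transform hh hf]
        congr 1
        refine lintegral_congr_ae ?_
        filter_upwards [hκfin x hxh, hgf] with y hy1 hy2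
        rw [ENNReal.ofReal_mul (hκ0 x y), hy1, ← hy2,
          Real.enorm_eq_ofReal ENNReal.toReal_nonneg]
      rw [hi, Real.enorm_eq_ofReal ENNReal.toReal_nonneg, ENNReal.ofReal_toReal hxA.ne]
    have hop2 : eLpNorm (integralOp μ κ g) 2 μ ^ 2 = ∫⁻ x, A x ^ 2 ∂μ := by
      rw [eLpNorm_two_sq]
      exact lintegral_congr_ae (hop.mono fun x hx => by simp only [hx])
    have hCS : (∫⁻ u, transform μ h f u ^ 2 ∂ζ) ^ 2 ≤
        (∫⁻ x, f x ^ 2 ∂μ) * ∫⁻ x, A x ^ 2 ∂μ := by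
      rw [hQ]
      exact sq_lintegral_mul_le μ hf.aemeasurable hAm.aemeasurable
    by_cases hg0 : eLpNorm g 2 μ = 0
    · rw [← hg2, hg0] at hCS
      have : (∫⁻ u, transform μ h f u ^ 2 ∂ζ) = 0 := by simpa using hCS
      rw [this]
      exact zero_le
    have hnorm : eLpNorm (integralOp μ κ g) 2 μ ≤ c * eLpNorm g 2 μ := by
      rw [← ENNReal.div_le_iff hg0 hgtop]
      refine le_trans ?_ hc
      exact le_iSup₂ (f := fun (f : X → ℝ) (_ : MemLp f 2 μ ∧ eLpNorm f 2 μ ≠ 0) =>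
        eLpNorm (integralOp μ κ f) 2 μ / eLpNorm f 2 μ) g
        ⟨⟨hgm.aestronglyMeasurable, hgtop.lt_top⟩, hg0⟩
    refine (ENNReal.pow_le_pow_left_iff two_ne_zero).1 (hCS.trans ?_)
    rw [← hop2, ← hg2]
    calc _ ≤ eLpNorm g 2 μ ^ 2 * (c * eLpNorm g 2 μ) ^ 2 := by gcongr
      _ = _ := by ring
  · intro hc
    refine iSup₂_le fun f' hf' => ?_
    obtain ⟨⟨hfm, hftop⟩, hf0⟩ := hf'
    rw [ENNReal.div_le_iff hf0 hftop.ne]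
    set f := hfm.mk f' with hfdef
    have hff : f' =ᵐ[μ] f := hfm.ae_eq_mk
    have hopf : integralOp μ κ f' = integralOp μ κ f := funext fun x =>
      integral_congr_ae (hff.mono fun y hy => by simp only [hy])
    rw [hopf, eLpNorm_congr_ae hff]
    rw [eLpNorm_congr_ae hff] at hftop
    set F : X → ℝ≥0∞ := fun x => ‖f x‖ₑ with hF
    have hFm : Measurable F := hfm.stronglyMeasurable_mk.measurable.enorm
    have hF2 : eLpNorm f 2 μ ^ 2 = ∫⁻ x, F x ^ 2 ∂μ := eLpNorm_two_sq _ _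
    have hF2top : ∫⁻ x, F x ^ 2 ∂μ ≠ ∞ := by
      rw [← hF2]
      exact ENNReal.pow_ne_top hftop.ne
    set A := adjTransform ζ h (transform μ h F) with hA
    have hAm : Measurable A := measurable_adjTransform hh (measurable_transform hh hFm)
    have hA2 : ∫⁻ x, A x ^ 2 ∂μ ≠ ∞ := lintegral_sq_adjTransform_ne_top hh hfin hFm hF2top
    have hle : ∀ x, ‖integralOp μ κ f x‖ₑ ≤ A x := fun x => by
      rw [hA, adjTransform_transform hh hFm]
      refine (enorm_integral_le_lintegral_enorm _).trans (lintegral_mono fun y => ?_)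
      rw [enorm_mul]
      gcongr
      refine (enorm_integral_le_lintegral_enorm _).trans (lintegral_mono fun u => ?_)
      rw [enorm_mul]
      simp
    have hAQ : (∫⁻ x, A x ^ 2 ∂μ) ^ 2 ≤
        (∫⁻ u, transform μ h F u ^ 2 ∂ζ) * ∫⁻ u, transform μ h A u ^ 2 ∂ζ := by
      have : ∫⁻ x, A x ^ 2 ∂μ = ∫⁻ u, transform μ h A u * transform μ h F u ∂ζ := by
        rw [lintegral_transform_mul hh hAm (measurable_transform hh hFm)]
        exact lintegral_congr fun x => sq _
      rw [this, mul_comm (∫⁻ u, transform μ h F u ^ 2 ∂ζ)]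
      exact sq_lintegral_mul_le ζ (measurable_transform hh hAm).aemeasurable
        (measurable_transform hh hFm).aemeasurable
    have hfinal : ∫⁻ x, A x ^ 2 ∂μ ≤ c ^ 2 * ∫⁻ x, F x ^ 2 ∂μ := by
      by_cases h0 : ∫⁻ x, A x ^ 2 ∂μ = 0
      · rw [h0]
        exact zero_le
      refine (ENNReal.mul_le_mul_iff_left h0 hA2).1 ?_
      calc _ = (∫⁻ x, A x ^ 2 ∂μ) ^ 2 := (sq _).symm
        _ ≤ _ := hAQ
        _ ≤ (c * ∫⁻ x, F x ^ 2 ∂μ) * (c * ∫⁻ x, A x ^ 2 ∂μ) :=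
          mul_le_mul' (hc F hFm hF2top) (hc A hAm hA2)
        _ = _ := by ring
    refine (ENNReal.pow_le_pow_left_iff two_ne_zero).1 ?_
    rw [mul_pow, hF2, eLpNorm_two_sq]
    refine le_trans (lintegral_mono fun x => ?_) hfinal
    exact pow_le_pow_left' (hle x) 2

end Gram

/-! ### Lebesgue measure on the half line -/

lemma leb_apply (A : Set ℝ≥0) : leb A = volume (((↑) : ℝ≥0 → ℝ) '' A) :=
  (MeasurableEmbedding.subtype_coe measurableSet_Ici).comap_apply _ _

lemma leb_Icc (a b : ℝ≥0) : leb (Icc a b) = ((b - a : ℝ≥0) : ℝ≥0∞) := by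
  have : ((↑) : ℝ≥0 → ℝ) '' Icc a b = Icc (a : ℝ) b := by
    ext x
    simp only [mem_image, mem_Icc]
    exact ⟨by rintro ⟨y, ⟨h1, h2⟩, rfl⟩; exact ⟨h1, h2⟩,
      fun ⟨h1, h2⟩ => ⟨⟨x, a.2.trans h1⟩, ⟨h1, h2⟩, rfl⟩⟩
  rw [leb_apply, this, Real.volume_Icc, ENNReal.ofReal]
  congr 1

lemma leb_Iic (b : ℝ≥0) : leb (Iic b) = b := by
  have h := leb_Icc 0 b
  rwa [← bot_eq_zero, Icc_bot, bot_eq_zero, tsub_zero] at h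

instance : SigmaFinite leb :=
  ⟨⟨⟨fun n => Iic n, fun _ => trivial, fun n => by rw [leb_Iic]; exact ENNReal.coe_lt_top,
    iUnion_eq_univ_iff.2 exists_nat_ge⟩⟩⟩

instance : NullSingletonClass leb where
  measure_singleton a := by rw [← Icc_self, leb_Icc, tsub_self, ENNReal.coe_zero]

lemma leb_Ioc (a b : ℝ≥0) : leb (Ioc a b) = ((b - a : ℝ≥0) : ℝ≥0∞) := by
  rw [measure_congr Ioc_ae_eq_Icc, leb_Icc]

/-! ### Measurability of the evaluation on path space -/

lemma measurable_eval (r : ℝ≥0) : Measurable fun w : PathSpace => w.1 r :=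
  (measurable_pi_apply r).comp measurable_subtype_coe

/-- Right continuity makes the evaluation a limit of evaluations at the grid points
`(⌊n r⌋ + 1) / n`, which decrease to `r`. -/
lemma measurable_eval_uncurry : Measurable fun q : ℝ≥0 × PathSpace => q.2.1 q.1 := by
  set r : ℕ → ℝ≥0 → ℝ≥0 := fun n u => ((⌊(n + 1 : ℝ≥0) * u⌋₊ + 1 : ℕ) : ℝ≥0) / (n + 1) with hr
  have hn : ∀ n : ℕ, (0 : ℝ≥0) < n + 1 := fun n => by positivity
  refine measurable_of_tendsto_metrizable (f := fun n (q : ℝ≥0 × PathSpace) => q.2.1 (r n q.1))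
    (fun n => ?_) ?_
  · have h1 : Measurable fun p : PathSpace × ℕ => p.1.1 (((p.2 + 1 : ℕ) : ℝ≥0) / (n + 1)) :=
      measurable_from_prod_countable_left fun m =>
        measurable_eval (((m + 1 : ℕ) : ℝ≥0) / (n + 1))
    have h2 : Measurable fun u : ℝ≥0 => ⌊(n + 1 : ℝ≥0) * u⌋₊ :=
      Nat.measurable_floor.comp (measurable_const.mul measurable_id)
    exact h1.comp (measurable_snd.prodMk (h2.comp measurable_fst))
  · refine tendsto_pi_nhds.2 fun q => ?_
    have hge : ∀ n, q.1 ≤ r n q.1 := fun n => by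
      rw [hr]
      simp only
      rw [le_div_iff₀ (hn n), mul_comm]
      push_cast
      exact (Nat.lt_floor_add_one _).le
    have hle : ∀ n, r n q.1 ≤ q.1 + 1 / ((n : ℝ≥0) + 1) := fun n => by
      rw [hr]
      simp only
      rw [div_le_iff₀ (hn n), add_mul q.1, one_div_mul_cancel (hn n).ne', mul_comm q.1]
      push_cast
      gcongr
      exact Nat.floor_le zero_le
    have hlim : Tendsto (fun n => r n q.1) atTop (𝓝[≥] q.1) := by
      refine tendsto_nhdsWithin_iff.2 ⟨?_, Eventually.of_forall hge⟩
      refine tendsto_of_tendsto_of_tendsto_of_le_of_le tendsto_const_nhds ?_ hge hle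
      simpa using tendsto_const_nhds.add (tendsto_one_div_add_atTop_nhds_zero_nat (𝕜 := ℝ≥0))
    exact (q.2.2.1 q.1).tendsto.comp hlim

/-! ### Second moments of the jump process -/

/-- A clock with hazard rate at most `k G` whose exponential variable is at least `1` takes at
least the time `1 / (k G)` to ring. -/
lemma add_le_ringTime {g : ℝ≥0 → ℝ≥0} {G : ℝ≥0} (hg : ∀ x, g x ≤ G) {k : ℕ} {δ : ℝ≥0}
    (hδ : k * G * δ ≤ 1) (u : ℝ≥0∞) {e : ℝ} (he : 1 ≤ e) : u + δ ≤ ringTime g k u e := by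
  refine le_iInf₂ fun r hr => ?_
  obtain ⟨hur, hr⟩ := hr
  lift u to ℝ≥0 using ne_top_of_le_ne_top ENNReal.coe_ne_top hur
  have hur' : u ≤ r := by exact_mod_cast hur
  have hset : {x : ℝ≥0 | (u : ℝ≥0∞) ≤ x ∧ x ≤ r} = Icc u r := by
    ext x
    simp
  have h1 : (1 : ℝ≥0∞) ≤ ((k * (G * (r - u)) : ℝ≥0) : ℝ≥0∞) := by
    calc (1 : ℝ≥0∞) ≤ ENNReal.ofReal e := by simpa using ENNReal.ofReal_le_ofReal he
      _ ≤ k * ∫⁻ x in Icc u r, (g x : ℝ≥0∞) ∂leb := by rw [← hset]; exact hr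
      _ ≤ k * ∫⁻ _ in Icc u r, (G : ℝ≥0∞) ∂leb := by
        gcongr with x
        exact hg x
      _ = _ := by
        rw [setLIntegral_const, leb_Icc]
        push_cast
        rfl
  have h2 : 1 ≤ k * G * (r - u) := by
    rw [mul_assoc]
    exact_mod_cast h1
  have h3 : 0 < k * G := pos_of_mul_pos_left (zero_lt_one.trans_le h2) zero_le
  have h4 : δ ≤ r - u := le_of_mul_le_mul_left (hδ.trans h2) h3
  have h5 : u + δ ≤ r := by
    calc u + δ ≤ u + (r - u) := by gcongr
      _ = r := add_tsub_cancel_of_le hur'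
  exact_mod_cast h5

lemma jumpChain_snd_le {K : ℕ} (γ : Fin K → ℝ≥0 → ℝ≥0) (k : ℕ) (s : ℝ≥0) (ω : ℕ × Fin K → ℝ)
    (n : ℕ) : (jumpChain γ k s ω n).2 ≤ k + n * K := by
  induction n with
  | zero => simp [jumpChain]
  | succ n ih =>
    simp only [jumpChain, step]
    set S : Set ℕ := {m : ℕ | ∃ j : Fin K, _ ∧ m = j + 1}
    have hS : sInf S ≤ K := by
      rcases S.eq_empty_or_nonempty with h | h
      · simp [h]
      · obtain ⟨j, -, hj⟩ := Nat.sInf_mem h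
        rw [hj]
        exact j.2
    calc _ ≤ (k + n * K) + K := add_le_add ih hS
      _ = _ := by ring

/-- The event that all `K` clocks have an exponential variable larger than `1`. -/
def slowClocks (K : ℕ) : Set (Fin K → ℝ) := {e | ∀ j, 1 < e j}

lemma measurableSet_slowClocks (K : ℕ) : MeasurableSet (slowClocks K) := by
  simp only [slowClocks, ofPred_forall]
  exact .iInter fun j => measurableSet_lt measurable_const (measurable_pi_apply j)

open Classical in
/-- The `n`-th jump time is at least the sum of the times `1 / ((m + 1) c)`, `c = (k + K) G`, over
the steps `m < n` with slow clocks: the state after `m` jumps is at most `k + m K`, so that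
`(m + 1) c` bounds the hazard rates of the clocks in step `m`. -/
lemma sum_le_jumpChain_fst {K : ℕ} {γ : Fin K → ℝ≥0 → ℝ≥0} {G : ℝ≥0} (hγ : ∀ j x, γ j x ≤ G)
    {k : ℕ} (hk : 0 < k) (hG : 0 < G) (s : ℝ≥0) (ω : ℕ × Fin K → ℝ) (n : ℕ) :
    ((∑ m ∈ Finset.range n, if (fun j => ω (m, j)) ∈ slowClocks K then
      1 / ((m + 1) * ((k + K) * G)) else 0 : ℝ≥0) : ℝ≥0∞) ≤ (jumpChain γ k s ω n).1 := by
  induction n with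
  | zero => simp
  | succ n ih =>
    rw [Finset.sum_range_succ]
    split_ifs with h
    · push_cast
      refine le_trans (add_le_add_left (by exact_mod_cast ih) _) ?_
      simp only [jumpChain, step]
      refine le_iInf fun j => ?_
      have := add_le_ringTime (hγ j) (k := (jumpChain γ k s ω n).2)
        (δ := 1 / ((n + 1) * ((k + K) * G))) ?_ (jumpChain γ k s ω n).1 (h j).le
      · exact_mod_cast this
      · have hc : 0 < ((n : ℝ≥0) + 1) * ((k + K) * G) := by positivity
        rw [mul_one_div, div_le_one hc, ← mul_assoc]
        gcongr
        have := jumpChain_snd_le γ k s ω n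
        have h2 : (jumpChain γ k s ω n).2 ≤ (n + 1) * (k + K) := this.trans (by nlinarith)
        exact_mod_cast h2
    · rw [add_zero]
      exact ih.trans (jumpChain_fst_mono γ k s ω n.le_succ)

lemma expMeasure_Ioi_pos : 0 < expMeasure 1 (Ioi 1) := by
  have := isProbabilityMeasure_expMeasure one_pos
  rw [← compl_Iic, prob_compl_eq_one_sub measurableSet_Iic, tsub_pos_iff_lt,
    ← ofReal_cdf, cdf_expMeasure_eq one_pos, ← ENNReal.ofReal_one]
  rw [ENNReal.ofReal_lt_ofReal_iff one_pos]
  split_ifs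
  · linarith [Real.exp_pos (-(1 * 1))]
  · exact one_pos

/-- The law of the `K` clocks of one step. -/
noncomputable def stepLaw (K : ℕ) : Measure (Fin K → ℝ) := Measure.infinitePi fun _ => expMeasure 1

instance (K : ℕ) : IsProbabilityMeasure (stepLaw K) := by
  have := isProbabilityMeasure_expMeasure one_pos
  unfold stepLaw
  infer_instance

lemma stepLaw_slowClocks_pos (K : ℕ) : 0 < stepLaw K (slowClocks K) := by
  have := isProbabilityMeasure_expMeasure one_pos
  have h : slowClocks K = Set.pi (Finset.univ : Finset (Fin K)) fun _ => Ioi (1 : ℝ) := by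
    ext e
    simp [slowClocks]
  rw [h, stepLaw, Measure.infinitePi_pi _ fun _ _ => measurableSet_Ioi, Finset.prod_const]
  exact ENNReal.pow_pos expMeasure_Ioi_pos _

/-- The clocks of different steps are independent. -/
lemma lintegral_prod_clockLaw {K : ℕ} {X : ℕ → (Fin K → ℝ) → ℝ≥0∞} (hX : ∀ m, Measurable (X m))
    (n : ℕ) :
    ∫⁻ ω, ∏ m ∈ Finset.range n, X m (fun j => ω (m, j)) ∂clockLaw K =
      ∏ m ∈ Finset.range n, ∫⁻ e, X m e ∂stepLaw K := by
  have := isProbabilityMeasure_expMeasure one_pos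
  have hmap : (clockLaw K).map (MeasurableEquiv.curry ℕ (Fin K) ℝ) =
      Measure.infinitePi fun _ => stepLaw K :=
    Measure.infinitePi_map_curry (fun (_ : ℕ) (_ : Fin K) => expMeasure 1)
  have hm : ∀ m, Measurable fun ω : ℕ → Fin K → ℝ => X m (ω m) := fun m =>
    (hX m).comp (measurable_pi_apply m)
  calc _ = ∫⁻ ω : ℕ → Fin K → ℝ, (∏ m ∈ Finset.range n, X m (ω m))
        ∂(clockLaw K).map (MeasurableEquiv.curry ℕ (Fin K) ℝ) := by
        rw [lintegral_map (Finset.measurable_prod _ fun m _ => hm m)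
          (MeasurableEquiv.curry ℕ (Fin K) ℝ).measurable]
        rfl
    _ = ∏ m ∈ Finset.range n, ∫⁻ ω : ℕ → Fin K → ℝ, X m (ω m)
        ∂(Measure.infinitePi fun _ : ℕ => stepLaw K) := by
        rw [hmap]
        exact lintegral_prod_eq_prod_lintegral_of_indepFun _
          (fun m (ω : ℕ → Fin K → ℝ) => X m (ω m))
          (iIndepFun_infinitePi hX) hm
    _ = _ := by
        refine Finset.prod_congr rfl fun m _ => ?_
        have h := lintegral_map (μ := Measure.infinitePi fun _ : ℕ => stepLaw K) (hX m)
          (measurable_pi_apply m)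
        rw [Measure.infinitePi_map_eval] at h
        exact h.symm

open Classical in
/-- The factor `exp(-L / (m + 1))` on the event of slow clocks, and `1` off this event. -/
noncomputable def slowFactor (K : ℕ) (L : ℝ) (m : ℕ) (e : Fin K → ℝ) : ℝ :=
  if e ∈ slowClocks K then Real.exp (-(L / (m + 1))) else 1

lemma measurable_slowFactor (K : ℕ) (L : ℝ) (m : ℕ) : Measurable (slowFactor K L m) :=
  Measurable.ite (measurableSet_slowClocks K) measurable_const measurable_const

lemma slowFactor_nonneg {K : ℕ} (L : ℝ) (m : ℕ) (e : Fin K → ℝ) : 0 ≤ slowFactor K L m e := by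
  unfold slowFactor
  split_ifs <;> positivity

lemma prod_telescope {L : ℝ} (hL : 0 < L) (n : ℕ) :
    ∏ m ∈ Finset.range n, ((m + L) / (m + 1 + L)) ^ 4 = (L / (n + L)) ^ 4 := by
  rw [Finset.prod_pow]
  congr 1
  induction n with
  | zero => simp [hL.ne']
  | succ n ih =>
    rw [Finset.prod_range_succ, ih]
    push_cast
    field_simp

/-- For `L = 4 / p`, with `p` the probability of slow clocks, the mean of a factor is at most
`1 - 4 / (m + 1 + L)`, and Bernoulli's inequality turns this into a bound with a telescoping
product. -/
lemma lintegral_slowFactor_le {K : ℕ} {L : ℝ} (hL : 0 < L)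
    (hp : (stepLaw K).real (slowClocks K) * L = 4) (m : ℕ) :
    ∫⁻ e, ENNReal.ofReal (slowFactor K L m e) ∂stepLaw K ≤
      ENNReal.ofReal (((m + L) / (m + 1 + L)) ^ 4) := by
  have hd : (0 : ℝ) < m + 1 + L := by positivity
  have hint : Integrable (slowFactor K L m) (stepLaw K) := by
    refine Integrable.of_bound (measurable_slowFactor K L m).aestronglyMeasurable 1
      (Eventually.of_forall fun e => ?_)
    unfold slowFactor
    split_ifs
    · rw [Real.norm_eq_abs, Real.abs_exp]
      exact Real.exp_le_one_iff.2 (neg_nonpos.2 (by positivity))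
    · simp
  rw [← ofReal_integral_eq_lintegral_ofReal hint (Eventually.of_forall (slowFactor_nonneg L m))]
  refine ENNReal.ofReal_le_ofReal ?_
  have hS := measurableSet_slowClocks K
  set p := (stepLaw K).real (slowClocks K) with hpdef
  have hval : ∫ e, slowFactor K L m e ∂stepLaw K = 1 - p + p * Real.exp (-(L / (m + 1))) := by
    have h1 : ∫ e in slowClocks K, slowFactor K L m e ∂stepLaw K =
        ∫ _ in slowClocks K, Real.exp (-(L / (m + 1))) ∂stepLaw K :=
      setIntegral_congr_fun hS fun e he => if_pos he
    have h2 : ∫ e in (slowClocks K)ᶜ, slowFactor K L m e ∂stepLaw K =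
        ∫ _ in (slowClocks K)ᶜ, (1 : ℝ) ∂stepLaw K :=
      setIntegral_congr_fun hS.compl fun e he => if_neg he
    rw [← integral_add_compl hS hint, h1, h2]
    simp only [setIntegral_const, probReal_compl_eq_one_sub hS, smul_eq_mul, ← hpdef]
    ring
  have hexp : Real.exp (-(L / (m + 1))) ≤ (m + 1) / (m + 1 + L) := by
    have h1 : L / (m + 1) + 1 ≤ Real.exp (L / (m + 1)) := Real.add_one_le_exp _
    rw [Real.exp_neg, inv_le_comm₀ (Real.exp_pos _) (by positivity), inv_div]
    refine le_trans (le_of_eq ?_) h1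
    field_simp
    ring
  have hbern := one_add_mul_le_pow (a := -(1 / (m + 1 + L))) (by
    have : 1 / (m + 1 + L) ≤ 1 := (div_le_one hd).2 (by linarith [(Nat.cast_nonneg m : (0:ℝ) ≤ m)])
    linarith) 4
  have hp0 : 0 ≤ p := measureReal_nonneg
  calc ∫ e, slowFactor K L m e ∂stepLaw K
      ≤ 1 - p + p * ((m + 1) / (m + 1 + L)) := by rw [hval]; gcongr
    _ = 1 + (4 : ℕ) * -(1 / (m + 1 + L)) := by
      push_cast
      field_simp
      linarith
    _ ≤ _ := hbern
    _ = _ := by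
      congr 1
      field_simp
      ring

/-- Tail bound for the number of jumps up to time `r`, uniform in the starting time. -/
lemma exists_jumpChain_tail {K : ℕ} {γ : Fin K → ℝ≥0 → ℝ≥0} {G : ℝ≥0} (hγ : ∀ j x, γ j x ≤ G)
    {k : ℕ} (hk : 0 < k) (hG : 0 < G) (T : ℝ≥0) :
    ∃ C : ℝ≥0, ∀ s r : ℝ≥0, r ≤ T → ∀ n : ℕ, 0 < n →
      clockLaw K {ω | (jumpChain γ k s ω n).1 ≤ r} ≤ C * ENNReal.ofReal ((1 / (n : ℝ)) ^ 4) := by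
  classical
  have hp : 0 < (stepLaw K).real (slowClocks K) :=
    ENNReal.toReal_pos (stepLaw_slowClocks_pos K).ne' (measure_ne_top _ _)
  -- the exponent `4 = p L` of the tail makes the second moments summable
  obtain ⟨L, hL, hpL⟩ : ∃ L : ℝ, 0 < L ∧ (stepLaw K).real (slowClocks K) * L = 4 :=
    ⟨4 / (stepLaw K).real (slowClocks K), by positivity, by field_simp⟩
  set c : ℝ≥0 := (k + K) * G with hc
  have hc0 : 0 < c := by positivity
  set E : ℝ := Real.exp (L * c * T) with hE
  refine ⟨(E * L ^ 4).toNNReal, fun s r hr n hn => ?_⟩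
  set F : (ℕ × Fin K → ℝ) → ℝ≥0∞ := fun ω =>
    ∏ m ∈ Finset.range n, ENNReal.ofReal (slowFactor K L m fun j => ω (m, j)) with hF
  have hmeas : MeasurableSet {ω | (jumpChain γ k s ω n).1 ≤ r} :=
    measurableSet_le ((measurable_jumpChain γ k n).comp measurable_prodMk_left).fst
      measurable_const
  -- an exponential Markov inequality
  have hpt : ∀ ω, {ω | (jumpChain γ k s ω n).1 ≤ r}.indicator 1 ω ≤ ENNReal.ofReal E * F ω := by
    intro ω
    by_cases hω : (jumpChain γ k s ω n).1 ≤ r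
    swap
    · rw [indicator_of_notMem (by exact hω)]
      exact zero_le
    rw [indicator_of_mem (by exact hω), Pi.one_apply]
    simp only [hF]
    rw [← ENNReal.ofReal_prod_of_nonneg fun m _ => slowFactor_nonneg L m _, ← ENNReal.ofReal_mul (by positivity), ← ENNReal.ofReal_one]
    refine ENNReal.ofReal_le_ofReal ?_
    have hsum := (sum_le_jumpChain_fst hγ hk hG s ω n).trans hω
    rw [ENNReal.coe_le_coe, ← NNReal.coe_le_coe, NNReal.coe_sum] at hsum
    simp only [apply_ite NNReal.toReal] at hsum
    push_cast at hsum
    have hprod : ∏ m ∈ Finset.range n, slowFactor K L m (fun j => ω (m, j)) =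
        Real.exp (-(L * c * ∑ m ∈ Finset.range n,
          if (fun j => ω (m, j)) ∈ slowClocks K then 1 / (((m : ℝ) + 1) * ((k + K) * G)) else 0)) := by
      rw [Finset.mul_sum, ← Finset.sum_neg_distrib, Real.exp_sum]
      refine Finset.prod_congr rfl fun m _ => ?_
      unfold slowFactor
      split_ifs
      · congr 2
        have h1 : (c : ℝ) = (k + K) * G := by rw [hc]; push_cast; rfl
        have h2 : (0 : ℝ) < c := hc0
        rw [← h1]
        field_simp
      · simp
    rw [hprod, hE, ← Real.exp_add]
    refine Real.one_le_exp ?_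
    have hT : (r : ℝ) ≤ T := hr
    have := mul_le_mul_of_nonneg_left (hsum.trans hT) (by positivity : 0 ≤ L * c)
    linarith
  calc clockLaw K {ω | (jumpChain γ k s ω n).1 ≤ r}
      = ∫⁻ ω, {ω | (jumpChain γ k s ω n).1 ≤ r}.indicator 1 ω ∂clockLaw K :=
        (lintegral_indicator_one hmeas).symm
    _ ≤ ∫⁻ ω, ENNReal.ofReal E * F ω ∂clockLaw K := lintegral_mono hpt
    _ = ENNReal.ofReal E * ∏ m ∈ Finset.range n,
          ∫⁻ e, ENNReal.ofReal (slowFactor K L m e) ∂stepLaw K := by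
        rw [lintegral_const_mul' _ _ ENNReal.ofReal_ne_top, hF,
          lintegral_prod_clockLaw fun m => (measurable_slowFactor K L m).ennreal_ofReal]
    _ ≤ ENNReal.ofReal E * ∏ m ∈ Finset.range n,
          ENNReal.ofReal (((m + L) / (m + 1 + L)) ^ 4) := by
        gcongr with m
        exact lintegral_slowFactor_le hL hpL m
    _ = ENNReal.ofReal (E * (L / (n + L)) ^ 4) := by
        rw [← ENNReal.ofReal_prod_of_nonneg fun m _ => by positivity, prod_telescope hL,
          ← ENNReal.ofReal_mul (by positivity)]
    _ ≤ ENNReal.ofReal (E * L ^ 4 * (1 / (n : ℝ)) ^ 4) := by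
        rw [mul_assoc, ← mul_pow, mul_one_div]
        have hn' : (0 : ℝ) < n := by exact_mod_cast hn
        gcongr
        linarith
    _ = _ := by
        rw [ENNReal.ofReal_mul (by positivity)]
        rfl

/-- If the path has made exactly `n + 1` jumps up to time `r`, the `n`-th term of the series bounds
the square; if it has made none, or explodes, `k ^ 2` does. -/
lemma pathFun_sq_le {K : ℕ} (γ : Fin K → ℝ≥0 → ℝ≥0) (k : ℕ) (s : ℝ≥0) (ω : ℕ × Fin K → ℝ)
    (r : ℝ≥0) :
    (pathFun γ k s ω r : ℝ≥0∞) ^ 2 ≤ (k : ℝ≥0∞) ^ 2 +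
      ∑' n : ℕ, {ω | (jumpChain γ k s ω (n + 1)).1 ≤ r}.indicator 1 ω *
        ((k + (n + 1) * K : ℕ) : ℝ≥0∞) ^ 2 := by
  have hk : (k : ℝ≥0∞) ^ 2 ≤ (k : ℝ≥0∞) ^ 2 +
      ∑' n : ℕ, {ω | (jumpChain γ k s ω (n + 1)).1 ≤ r}.indicator 1 ω *
        ((k + (n + 1) * K : ℕ) : ℝ≥0∞) ^ 2 := le_self_add
  unfold pathFun
  split_ifs with h1 h2
  · simp
  · set N := sInf {n | (r : ℝ≥0∞) < (jumpChain γ k s ω (n + 1)).1} with hN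
    rcases hN' : N with _ | n
    · simpa only [jumpChain] using hk
    · have hn : (jumpChain γ k s ω (n + 1)).1 ≤ r :=
        not_lt.1 fun h => Nat.notMem_of_lt_sInf
          (show n < sInf {n | (r : ℝ≥0∞) < (jumpChain γ k s ω (n + 1)).1} by omega) h
      refine le_trans ?_ (le_add_left (ENNReal.le_tsum n))
      rw [indicator_of_mem (by exact hn), Pi.one_apply, one_mul]
      gcongr
      exact jumpChain_snd_le γ k s ω (n + 1)
  · exact hk

/-- The second moment of the process is bounded, uniformly in the starting time, on bounded time
intervals. -/
theorem exists_lintegral_path_sq_le {K : ℕ} {γ : Fin K → ℝ≥0 → ℝ≥0} {G : ℝ≥0}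
    (hγ : ∀ j x, γ j x ≤ G) {k : ℕ} (hk : 0 < k) (hG : 0 < G) (T : ℝ≥0) :
    ∃ M : ℝ≥0, ∀ s r : ℝ≥0, r ≤ T →
      ∫⁻ ω, ((path γ k s ω).1 r : ℝ≥0∞) ^ 2 ∂clockLaw K ≤ M := by
  obtain ⟨C, hC⟩ := exists_jumpChain_tail hγ hk hG T
  have hsum : ∑' n : ℕ, ENNReal.ofReal ((1 / ((n + 1 : ℕ) : ℝ)) ^ 2) ≠ ∞ := by
    refine Summable.tsum_ofReal_ne_top ?_
    have h := (summable_nat_add_iff 1).2 (Real.summable_one_div_nat_pow.2 one_lt_two)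
    simpa only [one_div_pow] using h
  set B : ℝ≥0∞ := (k : ℝ≥0∞) ^ 2 +
    C * ((k + K : ℕ) : ℝ≥0∞) ^ 2 * ∑' n : ℕ, ENNReal.ofReal ((1 / ((n + 1 : ℕ) : ℝ)) ^ 2) with hB
  have hBtop : B ≠ ∞ := by
    refine ENNReal.add_ne_top.2 ⟨by simp, ENNReal.mul_ne_top (ENNReal.mul_ne_top (by simp) ?_) hsum⟩
    exact ENNReal.pow_ne_top (ENNReal.natCast_ne_top _)
  refine ⟨B.toNNReal, fun s r hr => ?_⟩
  rw [ENNReal.coe_toNNReal hBtop]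
  have hmeas : ∀ n, MeasurableSet {ω | (jumpChain γ k s ω n).1 ≤ r} := fun n =>
    measurableSet_le ((measurable_jumpChain γ k n).comp measurable_prodMk_left).fst
      measurable_const
  have hterm : ∀ n : ℕ, clockLaw K {ω | (jumpChain γ k s ω (n + 1)).1 ≤ r} *
      ((k + (n + 1) * K : ℕ) : ℝ≥0∞) ^ 2 ≤
      C * ((k + K : ℕ) : ℝ≥0∞) ^ 2 * ENNReal.ofReal ((1 / ((n + 1 : ℕ) : ℝ)) ^ 2) := fun n => by
    have h1 : k + (n + 1) * K ≤ (k + K) * (n + 1) := by nlinarith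
    have h2 : ENNReal.ofReal ((1 / ((n + 1 : ℕ) : ℝ)) ^ 4) * ((n + 1 : ℕ) : ℝ≥0∞) ^ 2 =
        ENNReal.ofReal ((1 / ((n + 1 : ℕ) : ℝ)) ^ 2) := by
      rw [← ENNReal.ofReal_natCast, ← ENNReal.ofReal_pow (by positivity),
        ← ENNReal.ofReal_mul (by positivity)]
      congr 1
      field_simp
    calc _ ≤ C * ENNReal.ofReal ((1 / ((n + 1 : ℕ) : ℝ)) ^ 4) *
          (((k + K) * (n + 1) : ℕ) : ℝ≥0∞) ^ 2 := by
          gcongr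
          exact hC s r hr (n + 1) n.succ_pos
      _ = _ := by
        rw [← h2, Nat.cast_mul, mul_pow]
        ring
  calc ∫⁻ ω, ((path γ k s ω).1 r : ℝ≥0∞) ^ 2 ∂clockLaw K
      ≤ ∫⁻ ω, ((k : ℝ≥0∞) ^ 2 +
        ∑' n : ℕ, {ω | (jumpChain γ k s ω (n + 1)).1 ≤ r}.indicator 1 ω *
          ((k + (n + 1) * K : ℕ) : ℝ≥0∞) ^ 2) ∂clockLaw K :=
        lintegral_mono fun ω => pathFun_sq_le γ k s ω r
    _ = (k : ℝ≥0∞) ^ 2 + ∑' n : ℕ, clockLaw K {ω | (jumpChain γ k s ω (n + 1)).1 ≤ r} *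
          ((k + (n + 1) * K : ℕ) : ℝ≥0∞) ^ 2 := by
        rw [lintegral_add_left measurable_const, lintegral_const, measure_univ, mul_one,
          lintegral_tsum fun n =>
            ((measurable_one.indicator (hmeas (n + 1))).mul_const _).aemeasurable]
        congr 2
        funext n
        rw [lintegral_mul_const _ (measurable_one.indicator (hmeas (n + 1))),
          lintegral_indicator_one (hmeas (n + 1))]
    _ ≤ B := by
        rw [hB, ← ENNReal.tsum_mul_left]
        exact add_le_add_right (ENNReal.tsum_le_tsum hterm) _

/-! ### The type measure -/

instance {K : ℕ} (γ : Fin K → ℝ≥0 → ℝ≥0) (i : Fin K) : IsMarkovKernel (pathLaw γ i) :=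
  ⟨fun _ => Measure.isProbabilityMeasure_map
    ((measurable_path γ (K + (i + 1))).comp measurable_prodMk_left).aemeasurable⟩

lemma lintegral_pathLaw {K : ℕ} (γ : Fin K → ℝ≥0 → ℝ≥0) (i : Fin K) (s : ℝ≥0)
    {F : PathSpace → ℝ≥0∞} (hF : Measurable F) :
    ∫⁻ w, F w ∂pathLaw γ i s = ∫⁻ ω, F (path γ (K + (i + 1)) s ω) ∂clockLaw K :=
  lintegral_map hF ((measurable_path γ (K + (i + 1))).comp measurable_prodMk_left)

/-- The type measure without the restriction to starting times in `[0, t]`. -/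
noncomputable def fullTypeMeasure {K : ℕ} (R : RateFunctions K) : Measure TypeSpace :=
  ∑ i, (leb.withDensity fun u => (R.α i u : ℝ≥0∞)) ⊗ₘ pathLaw R.γ i

instance {K : ℕ} (R : RateFunctions K) : SFinite (fullTypeMeasure R) := by
  unfold fullTypeMeasure
  rw [← Measure.sum_fintype]
  infer_instance

lemma typeMeasure_eq_restrict {K : ℕ} (R : RateFunctions K) (t : ℝ≥0) :
    typeMeasure R t = (fullTypeMeasure R).restrict (Iic t ×ˢ univ) := by
  have hS : MeasurableSet (Iic t ×ˢ (univ : Set PathSpace)) := measurableSet_Iic.prod .univ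
  ext A hA
  rw [Measure.restrict_apply hA, typeMeasure, fullTypeMeasure, Measure.finsetSum_apply,
    Measure.finsetSum_apply]
  refine Finset.sum_congr rfl fun i _ => ?_
  rw [Measure.compProd_apply hA, Measure.compProd_apply (hA.inter hS),
    ← restrict_withDensity measurableSet_Iic, ← lintegral_indicator measurableSet_Iic]
  refine lintegral_congr fun s => ?_
  by_cases hs : s ∈ Iic t
  · rw [indicator_of_mem hs]
    congr 1
    ext w
    simpa using fun _ => hs
  · rw [indicator_of_notMem hs]
    have : Prod.mk s ⁻¹' (A ∩ Iic t ×ˢ univ) = (∅ : Set PathSpace) := by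
      ext w
      simpa using fun _ => hs
    rw [this, measure_empty]

lemma ae_fullTypeMeasure {K : ℕ} (R : RateFunctions K) {p : TypeSpace → Prop}
    (hp : MeasurableSet {x | p x}) (h : ∀ k, 0 < k → ∀ s ω, p (s, path R.γ k s ω)) :
    ∀ᵐ x ∂fullTypeMeasure R, p x := by
  rw [ae_iff, fullTypeMeasure, Measure.finsetSum_apply]
  refine Finset.sum_eq_zero fun i _ => ?_
  rw [← ae_iff]
  refine Measure.ae_compProd_of_ae_ae hp (Eventually.of_forall fun s => ?_)
  refine (ae_map_iff ((measurable_path R.γ (K + (i + 1))).comp measurable_prodMk_left).aemeasurable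
    (measurable_prodMk_left hp)).2 (Eventually.of_forall fun ω => h _ (by omega) s ω)

/-- The state of the path of a type at time `u`. -/
def pathValue (u : ℝ≥0) (x : TypeSpace) : ℝ≥0 := x.2.1 u

lemma measurable_pathValue : Measurable (Function.uncurry pathValue) := by
  have h : Measurable fun q : ℝ≥0 × TypeSpace => q.2.2.1 q.1 :=
    measurable_eval_uncurry.comp (measurable_fst.prodMk measurable_snd.snd)
  exact (measurable_of_countable (fun n : ℕ => (n : ℝ≥0))).comp h

lemma measurable_pathValue_right (u : ℝ≥0) : Measurable (pathValue u) :=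
  measurable_pathValue.comp measurable_prodMk_left

lemma ae_pathValue_eq_zero {K : ℕ} (R : RateFunctions K) (u : ℝ≥0) :
    ∀ᵐ x ∂fullTypeMeasure R, u < x.1 → pathValue u x = 0 := by
  refine ae_fullTypeMeasure R ?_ fun k _ s ω (hs : u < s) => ?_
  · simp only [imp_iff_not_or, ofPred_or]
    exact (measurableSet_lt measurable_const measurable_fst).compl.union
      (measurable_pathValue_right u (measurableSet_singleton 0))
  · simp [pathValue, path, pathFun, hs]

lemma ae_pathValue_mono {K : ℕ} (R : RateFunctions K) {u v : ℝ≥0} (huv : u ≤ v) :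
    ∀ᵐ x ∂fullTypeMeasure R, pathValue u x ≤ pathValue v x := by
  refine ae_fullTypeMeasure R
    (measurableSet_le (measurable_pathValue_right u) (measurable_pathValue_right v))
    fun k _ s ω => ?_
  exact Nat.cast_le.2 (pathFun_mono R.γ k s ω huv)

lemma le_pathFun {K : ℕ} (γ : Fin K → ℝ≥0 → ℝ≥0) (k : ℕ) {s r : ℝ≥0} (hsr : s ≤ r)
    (ω : ℕ × Fin K → ℝ) : k ≤ pathFun γ k s ω r := by
  unfold pathFun
  rw [if_neg hsr.not_gt]
  split_ifs
  · exact jumpChain_snd_mono γ k s ω (Nat.zero_le _)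
  · exact le_rfl

lemma ae_one_le_pathValue {K : ℕ} (R : RateFunctions K) (u : ℝ≥0) :
    ∀ᵐ x ∂fullTypeMeasure R, x.1 ≤ u → 1 ≤ pathValue u x := by
  refine ae_fullTypeMeasure R ?_ fun k hk s ω (hs : s ≤ u) => ?_
  · simp only [imp_iff_not_or, ofPred_or]
    exact (measurableSet_le measurable_fst measurable_const).compl.union
      (measurableSet_le measurable_const (measurable_pathValue_right u))
  · exact Nat.one_le_cast.2 (hk.trans_le (le_pathFun R.γ k hs ω))

lemma exists_withDensity_le {g : ℝ≥0 → ℝ≥0} (hg : BddAbove (range g)) :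
    ∃ a : ℝ≥0, ∀ A, MeasurableSet A →
      (leb.withDensity fun u => (g u : ℝ≥0∞)) A ≤ a * leb A := by
  obtain ⟨a, ha⟩ := hg
  refine ⟨a, fun A hA => ?_⟩
  rw [withDensity_apply _ hA, ← setLIntegral_const]
  exact lintegral_mono fun u => ENNReal.coe_le_coe.2 (ha (mem_range_self u))

theorem exists_lintegral_pathValue_sq_le {K : ℕ} (R : RateFunctions K) (T : ℝ≥0) :
    ∃ M : ℝ≥0, ∀ u ≤ T, ∫⁻ x, (pathValue u x : ℝ≥0∞) ^ 2 ∂fullTypeMeasure R ≤ M := by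
  choose b hb using R.bdd_γ
  have hγ : ∀ j x, R.γ j x ≤ (∑ i, b i) + 1 := fun j x =>
    ((hb j (mem_range_self x)).trans (Finset.single_le_sum (fun _ _ => zero_le)
      (Finset.mem_univ j))).trans le_self_add
  choose M hM using fun i : Fin K => exists_lintegral_path_sq_le hγ
    (k := K + (i + 1)) (by omega) (by positivity) T
  choose a ha using fun i => exists_withDensity_le (R.bdd_α i)
  refine ⟨∑ i, M i * (a i * T), fun u hu => ?_⟩
  rw [fullTypeMeasure, lintegral_finsetSum_measure]
  push_cast
  refine Finset.sum_le_sum fun i _ => ?_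
  have hsq : Measurable fun x : TypeSpace => (pathValue u x : ℝ≥0∞) ^ 2 :=
    (measurable_pathValue_right u).coe_nnreal_ennreal.pow_const 2
  rw [Measure.lintegral_compProd hsq]
  have hle : ∀ s, ∫⁻ w, (pathValue u (s, w) : ℝ≥0∞) ^ 2 ∂pathLaw R.γ i s ≤
      (Iic T).indicator (fun _ => (M i : ℝ≥0∞)) s := fun s => by
    rw [lintegral_pathLaw R.γ i s (F := fun w => (pathValue u (s, w) : ℝ≥0∞) ^ 2)
      (hsq.comp measurable_prodMk_left)]
    by_cases hs : s ≤ T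
    · rw [indicator_of_mem (by exact hs)]
      simpa [pathValue] using hM i s u hu
    · have : u < s := hu.trans_lt (not_le.1 hs)
      simp [pathValue, path, pathFun, this]
  refine (lintegral_mono hle).trans ?_
  rw [lintegral_indicator_const measurableSet_Iic]
  gcongr
  refine (ha i _ measurableSet_Iic).trans_eq ?_
  rw [leb_Iic]

/-! ### The norm as a constant in a quadratic inequality -/

/-- The measure `β(u) du`. -/
noncomputable def rateMeasure {K : ℕ} (R : RateFunctions K) : Measure ℝ≥0 :=
  leb.withDensity fun u => (R.β u : ℝ≥0∞)

instance {K : ℕ} (R : RateFunctions K) : SFinite (rateMeasure R) := by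
  unfold rateMeasure
  infer_instance

lemma rateMeasure_ne_top {K : ℕ} (R : RateFunctions K) {A : Set ℝ≥0} (hA : MeasurableSet A)
    (h : leb A ≠ ∞) : rateMeasure R A ≠ ∞ := by
  obtain ⟨b, hb⟩ := exists_withDensity_le R.bdd_β
  exact ne_top_of_le_ne_top (ENNReal.mul_ne_top ENNReal.coe_ne_top h) (hb A hA)

lemma rateMeasure_Iic_ne_top {K : ℕ} (R : RateFunctions K) (t : ℝ≥0) :
    rateMeasure R (Iic t) ≠ ∞ :=
  rateMeasure_ne_top R measurableSet_Iic (by rw [leb_Iic]; exact ENNReal.coe_ne_top)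

lemma typeKernel_eq {K : ℕ} (R : RateFunctions K) (t : ℝ≥0) :
    typeKernel R t = fun x y =>
      ∫ u, (pathValue u x : ℝ) * (pathValue u y : ℝ) ∂(rateMeasure R).restrict (Iic t) := by
  funext x y
  rw [rateMeasure, restrict_withDensity measurableSet_Iic,
    integral_withDensity_eq_integral_smul R.continuous_β.measurable]
  refine integral_congr_ae (Eventually.of_forall fun u => ?_)
  simp only [pathValue, NNReal.smul_def, smul_eq_mul, NNReal.coe_natCast]
  ring

/-- `ρ(t)` is the least `c` with `∫_{[0, t]} (∫ w(u) f(s, w) dμ)² β(u) du ≤ c ∫ f² dμ`. Here `μ` does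
not depend on `t`: a path that starts after time `t` vanishes on `[0, t]`. -/
theorem rho_le_iff {K : ℕ} (R : RateFunctions K) (t : ℝ≥0) (c : ℝ≥0∞) :
    rho R t ≤ c ↔ ∀ f : TypeSpace → ℝ≥0∞, Measurable f → ∫⁻ x, f x ^ 2 ∂fullTypeMeasure R ≠ ∞ →
      ∫⁻ u in Iic t, transform (fullTypeMeasure R) pathValue f u ^ 2 ∂rateMeasure R ≤
        c * ∫⁻ x, f x ^ 2 ∂fullTypeMeasure R := by
  have hS : MeasurableSet (Iic t ×ˢ (univ : Set PathSpace)) := measurableSet_Iic.prod .univ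
  have hfin : ∫⁻ u in Iic t, ∫⁻ x, (pathValue u x : ℝ≥0∞) ^ 2 ∂typeMeasure R t ∂rateMeasure R
      ≠ ∞ := by
    obtain ⟨M, hM⟩ := exists_lintegral_pathValue_sq_le R t
    refine ne_top_of_le_ne_top
      (ENNReal.mul_ne_top (ENNReal.coe_ne_top (r := M)) (rateMeasure_Iic_ne_top R t)) ?_
    rw [← setLIntegral_const]
    refine setLIntegral_mono measurable_const fun u hu => ?_
    rw [typeMeasure_eq_restrict]
    exact (setLIntegral_le_lintegral _ _).trans (hM u hu)
  have : SFinite (typeMeasure R t) := by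
    rw [typeMeasure_eq_restrict]
    infer_instance
  rw [rho, typeKernel_eq, integralOpNorm_le_iff measurable_pathValue hfin]
  simp only [typeMeasure_eq_restrict R t]
  constructor
  · intro h f hf hf2
    have hf2' := setLIntegral_le_lintegral (μ := fullTypeMeasure R) (Iic t ×ˢ univ)
      fun x => f x ^ 2
    refine le_trans (le_of_eq ?_) ((h f hf (ne_top_of_le_ne_top hf2 hf2')).trans ?_)
    · refine setLIntegral_congr_fun measurableSet_Iic fun u hu => ?_
      congr 1
      rw [transform, transform, ← lintegral_indicator hS]
      refine lintegral_congr_ae ?_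
      filter_upwards [ae_pathValue_eq_zero R u] with x hx
      by_cases hxS : x.1 ≤ t
      · rw [indicator_of_mem (by exact ⟨hxS, trivial⟩)]
      · rw [indicator_of_notMem (fun h' => hxS h'.1), hx (lt_of_le_of_lt hu (not_le.1 hxS))]
        simp
    · gcongr
  · intro h f hf hf2
    have hsq : ∫⁻ x, (Iic t ×ˢ univ).indicator f x ^ 2 ∂fullTypeMeasure R =
        ∫⁻ x in Iic t ×ˢ univ, f x ^ 2 ∂fullTypeMeasure R := by
      rw [← lintegral_indicator hS]
      refine lintegral_congr fun x => ?_
      by_cases hx : x ∈ Iic t ×ˢ (univ : Set PathSpace) <;> simp [hx]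
    have htr : ∀ u, transform (fullTypeMeasure R) pathValue ((Iic t ×ˢ univ).indicator f) u =
        transform ((fullTypeMeasure R).restrict (Iic t ×ˢ univ)) pathValue f u := fun u => by
      rw [transform, transform, ← lintegral_indicator hS]
      refine lintegral_congr fun x => ?_
      by_cases hx : x ∈ Iic t ×ˢ (univ : Set PathSpace) <;> simp [hx]
    have := h _ (hf.indicator hS) (hsq ▸ hf2)
    simpa only [hsq, htr] using this

/-! ### Growth of the norm -/

lemma transform_mono {K : ℕ} (R : RateFunctions K) (f : TypeSpace → ℝ≥0∞) :
    Monotone (transform (fullTypeMeasure R) pathValue f) := fun u v huv => by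
  refine lintegral_mono_ae ?_
  filter_upwards [ae_pathValue_mono R huv] with x hx
  gcongr

lemma setLIntegral_Iic_add_Ioc {ζ : Measure ℝ≥0} {t t' : ℝ≥0} (h : t ≤ t') (F : ℝ≥0 → ℝ≥0∞) :
    ∫⁻ u in Iic t', F u ∂ζ = ∫⁻ u in Iic t, F u ∂ζ + ∫⁻ u in Ioc t t', F u ∂ζ := by
  rw [← Iic_union_Ioc_eq_Iic h]
  exact lintegral_union measurableSet_Ioc (Iic_disjoint_Ioc le_rfl)

/-- The norm grows at a bounded rate: by Cauchy-Schwarz the transform of a unit vector is bounded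
on bounded time intervals. -/
lemma exists_rho_le_add {K : ℕ} (R : RateFunctions K) (T : ℝ≥0) :
    ∃ C : ℝ≥0, ∀ t t', t ≤ t' → t' ≤ T → rho R t' ≤ rho R t + C * ((t' - t : ℝ≥0) : ℝ≥0∞) := by
  obtain ⟨M, hM⟩ := exists_lintegral_pathValue_sq_le R T
  obtain ⟨b, hb⟩ := exists_withDensity_le R.bdd_β
  refine ⟨M * b, fun t t' htt' ht' => (rho_le_iff R t' _).2 fun f hf hf2 => ?_⟩
  rw [setLIntegral_Iic_add_Ioc htt', add_mul]
  refine add_le_add ((rho_le_iff R t _).1 le_rfl f hf hf2) ?_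
  set N := ∫⁻ x, f x ^ 2 ∂fullTypeMeasure R
  calc ∫⁻ u in Ioc t t', transform (fullTypeMeasure R) pathValue f u ^ 2 ∂rateMeasure R
      ≤ ∫⁻ _ in Ioc t t', M * N ∂rateMeasure R := by
        refine setLIntegral_mono measurable_const fun u hu => ?_
        refine (sq_lintegral_mul_le _ (measurable_pathValue_right u).coe_nnreal_ennreal.aemeasurable
          hf.aemeasurable).trans ?_
        gcongr
        exact hM u (hu.2.trans ht')
    _ = M * N * rateMeasure R (Ioc t t') := setLIntegral_const _ _
    _ ≤ M * N * (b * leb (Ioc t t')) := by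
        gcongr
        exact hb _ measurableSet_Ioc
    _ = _ := by
        rw [leb_Ioc]
        push_cast
        ring

lemma rho_zero {K : ℕ} (R : RateFunctions K) : rho R 0 = 0 := by
  refine le_antisymm ((rho_le_iff R 0 0).2 fun f _ _ => ?_) zero_le
  have h0 : rateMeasure R (Iic 0) = 0 := by
    refine withDensity_absolutelyContinuous _ _ ?_
    rw [leb_Iic, ENNReal.coe_zero]
  rw [setLIntegral_measure_zero _ _ h0]
  exact zero_le

lemma rho_lt_top {K : ℕ} (R : RateFunctions K) (t : ℝ≥0) : rho R t < ∞ := by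
  obtain ⟨C, hC⟩ := exists_rho_le_add R t
  refine (hC 0 t zero_le le_rfl).trans_lt ?_
  rw [rho_zero, zero_add]
  exact ENNReal.mul_lt_top ENNReal.coe_lt_top ENNReal.coe_lt_top

/-- The quotient of `ρ(t)` and `∫_0^t β` is nondecreasing: the transform of a nonnegative function
is nondecreasing in time, because the paths are, and so is the `β`-average over `[0, t]` of its
square. -/
lemma rho_le_mul_div {K : ℕ} (R : RateFunctions K) {t t' : ℝ≥0} (htt' : t ≤ t')
    (h0 : rateMeasure R (Iic t') ≠ 0) :
    rho R t ≤ rho R t' * (rateMeasure R (Iic t) / rateMeasure R (Iic t')) := by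
  refine (rho_le_iff R t _).2 fun f hf hf2 => ?_
  set F := transform (fullTypeMeasure R) pathValue f with hF
  have hmono : Monotone F := transform_mono R f
  set N := ∫⁻ x, f x ^ 2 ∂fullTypeMeasure R
  set B := rateMeasure R (Iic t)
  set B' := rateMeasure R (Iic t') with hB'
  have hBB' : B' = B + rateMeasure R (Ioc t t') := by
    rw [hB', ← Iic_union_Ioc_eq_Iic htt',
      measure_union (Iic_disjoint_Ioc le_rfl) measurableSet_Ioc]
  have h1 : ∫⁻ u in Iic t, F u ^ 2 ∂rateMeasure R ≤ F t ^ 2 * B := by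
    rw [← setLIntegral_const]
    refine setLIntegral_mono measurable_const fun u hu => ?_
    exact pow_le_pow_left' (hmono hu) 2
  have h2 : F t ^ 2 * rateMeasure R (Ioc t t') ≤ ∫⁻ u in Ioc t t', F u ^ 2 ∂rateMeasure R := by
    rw [← setLIntegral_const]
    refine setLIntegral_mono' measurableSet_Ioc fun u hu => ?_
    exact pow_le_pow_left' (hmono hu.1.le) 2
  have h3 : (∫⁻ u in Iic t, F u ^ 2 ∂rateMeasure R) * B' ≤
      B * ∫⁻ u in Iic t', F u ^ 2 ∂rateMeasure R := by
    rw [setLIntegral_Iic_add_Ioc htt', hBB', mul_add, mul_add]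
    refine add_le_add (mul_comm _ _).le ?_
    calc _ ≤ F t ^ 2 * B * rateMeasure R (Ioc t t') := by gcongr
      _ = B * (F t ^ 2 * rateMeasure R (Ioc t t')) := by ring
      _ ≤ _ := by gcongr
  have h4 := (rho_le_iff R t' _).1 le_rfl f hf hf2
  calc ∫⁻ u in Iic t, F u ^ 2 ∂rateMeasure R
      ≤ (B * ∫⁻ u in Iic t', F u ^ 2 ∂rateMeasure R) / B' :=
        (ENNReal.le_div_iff_mul_le (Or.inl h0) (Or.inl (rateMeasure_Iic_ne_top R t'))).2 h3
    _ ≤ (B * (rho R t' * N)) / B' := by gcongr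
    _ = _ := by
        simp only [div_eq_mul_inv]
        ring

lemma rateMeasure_Ioc_pos {K : ℕ} {R : RateFunctions K} (hβ : ∀ t : ℝ≥0, 0 < t → 0 < R.β t)
    {a b : ℝ≥0} (hab : a < b) : 0 < rateMeasure R (Ioc a b) := by
  rw [rateMeasure, withDensity_apply _ measurableSet_Ioc,
    setLIntegral_pos_iff R.continuous_β.measurable.coe_nnreal_ennreal]
  have hsub : Ioc a b ⊆ Function.support (fun u => (R.β u : ℝ≥0∞)) ∩ Ioc a b := fun u hu =>
    ⟨by simpa using (hβ u (zero_le.trans_lt hu.1)).ne', hu⟩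
  refine lt_of_lt_of_le ?_ (measure_mono hsub)
  rw [leb_Ioc]
  exact ENNReal.coe_pos.2 (tsub_pos_of_lt hab)

lemma rateMeasure_Iic_lt {K : ℕ} {R : RateFunctions K} (hβ : ∀ t : ℝ≥0, 0 < t → 0 < R.β t)
    {a b : ℝ≥0} (hab : a < b) : rateMeasure R (Iic a) < rateMeasure R (Iic b) := by
  rw [← Iic_union_Ioc_eq_Iic hab.le, measure_union (Iic_disjoint_Ioc le_rfl) measurableSet_Ioc]
  exact ENNReal.lt_add_right (rateMeasure_Iic_ne_top R a) (rateMeasure_Ioc_pos hβ hab).ne'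

lemma fullTypeMeasure_pos {K : ℕ} {R : RateFunctions K}
    (hα : ∀ t : ℝ≥0, 0 < t → ∃ i, ∃ s ≤ t, 0 < R.α i s) {t : ℝ≥0} (ht : 0 < t) :
    0 < fullTypeMeasure R (Iic t ×ˢ univ) := by
  obtain ⟨i, s, hst, hs⟩ := hα t ht
  have hopen : IsOpen {u | 0 < R.α i u} := isOpen_lt continuous_const (R.continuous_α i)
  have hcl : s ∈ closure (Iio t) := by
    rw [closure_Iio' (a := t) ⟨0, ht⟩]
    exact hst
  obtain ⟨r, hr, hrt⟩ := mem_closure_iff.1 hcl _ hopen hs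
  obtain ⟨v, hv, hsub⟩ := mem_nhdsGE_iff_exists_Icc_subset.1
    (mem_nhdsWithin_of_mem_nhds ((hopen.inter isOpen_Iio).mem_nhds ⟨hr, hrt⟩))
  have hpos : 0 < (leb.withDensity fun u => (R.α i u : ℝ≥0∞)) (Iic t) := by
    rw [withDensity_apply _ measurableSet_Iic,
      setLIntegral_pos_iff (R.continuous_α i).measurable.coe_nnreal_ennreal]
    have hsub' : Icc r v ⊆ Function.support (fun u => (R.α i u : ℝ≥0∞)) ∩ Iic t := fun u hu => by
      obtain ⟨h1, h2⟩ := hsub hu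
      exact ⟨by simpa using (show 0 < R.α i u from h1).ne', (show u < t from h2).le⟩
    refine lt_of_lt_of_le ?_ (measure_mono hsub')
    rw [leb_Icc]
    exact ENNReal.coe_pos.2 (tsub_pos_of_lt hv)
  rw [fullTypeMeasure, Measure.finsetSum_apply]
  refine lt_of_lt_of_le ?_ (Finset.single_le_sum (fun _ _ => zero_le) (Finset.mem_univ i))
  rw [Measure.compProd_apply_prod measurableSet_Iic .univ]
  simpa using hpos

lemma rho_pos {K : ℕ} {R : RateFunctions K}
    (hα : ∀ t : ℝ≥0, 0 < t → ∃ i, ∃ s ≤ t, 0 < R.α i s)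
    (hβ : ∀ t : ℝ≥0, 0 < t → 0 < R.β t) {t : ℝ≥0} (ht : 0 < t) : 0 < rho R t := by
  refine pos_iff_ne_zero.2 fun h0 => ?_
  have hS : ∀ r : ℝ≥0, MeasurableSet (Iic r ×ˢ (univ : Set PathSpace)) := fun r =>
    measurableSet_Iic.prod .univ
  -- the test function is the indicator of the types that start in `[0, t]`
  set f : TypeSpace → ℝ≥0∞ := (Iic t ×ˢ univ).indicator 1 with hf
  have hfm : Measurable f := measurable_one.indicator (hS t)
  have hf2 : ∫⁻ x, f x ^ 2 ∂fullTypeMeasure R ≠ ∞ := by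
    obtain ⟨M, hM⟩ := exists_lintegral_pathValue_sq_le R t
    refine ne_top_of_le_ne_top (ENNReal.coe_ne_top (r := M)) (le_trans ?_ (hM t le_rfl))
    refine lintegral_mono_ae ?_
    filter_upwards [ae_one_le_pathValue R t] with x hx
    by_cases hxt : x ∈ Iic t ×ˢ (univ : Set PathSpace)
    · rw [hf, indicator_of_mem hxt, Pi.one_apply]
      gcongr
      exact_mod_cast hx hxt.1
    · rw [hf, indicator_of_notMem hxt]
      simp
  set F := transform (fullTypeMeasure R) pathValue f
  have hle := (rho_le_iff R t _).1 h0.le f hfm hf2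
  rw [zero_mul] at hle
  have hF : 0 < F (t / 2) := by
    refine (fullTypeMeasure_pos hα (half_pos ht)).trans_le ?_
    rw [← lintegral_indicator_one (hS _)]
    refine lintegral_mono_ae ?_
    filter_upwards [ae_one_le_pathValue R (t / 2)] with x hx
    by_cases hxt : x ∈ Iic (t / 2) ×ˢ (univ : Set PathSpace)
    · have hxt' : x ∈ Iic t ×ˢ (univ : Set PathSpace) :=
        ⟨(show x.1 ≤ t / 2 from hxt.1).trans (half_le_self zero_le), trivial⟩
      rw [indicator_of_mem hxt, hf, indicator_of_mem hxt', Pi.one_apply, mul_one]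
      exact_mod_cast hx hxt.1
    · rw [indicator_of_notMem hxt]
      exact zero_le
  have hlow : F (t / 2) ^ 2 * rateMeasure R (Ioc (t / 2) t) ≤
      ∫⁻ u in Iic t, F u ^ 2 ∂rateMeasure R := by
    rw [← setLIntegral_const]
    refine le_trans (setLIntegral_mono' measurableSet_Ioc fun u hu => ?_)
      (lintegral_mono_set Ioc_subset_Iic_self)
    exact pow_le_pow_left' (transform_mono R f hu.1.le) 2
  have hpos : 0 < F (t / 2) ^ 2 * rateMeasure R (Ioc (t / 2) t) :=
    ENNReal.mul_pos (pow_ne_zero 2 hF.ne') (rateMeasure_Ioc_pos hβ (half_lt_self ht)).ne'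
  exact absurd (hlow.trans hle) (not_le.2 hpos)

lemma strictMono_rho {K : ℕ} {R : RateFunctions K}
    (hα : ∀ t : ℝ≥0, 0 < t → ∃ i, ∃ s ≤ t, 0 < R.α i s)
    (hβ : ∀ t : ℝ≥0, 0 < t → 0 < R.β t) : StrictMono (rho R) := fun t t' htt' => by
  have hlt := rateMeasure_Iic_lt hβ htt'
  have h0 : rateMeasure R (Iic t') ≠ 0 := (zero_le.trans_lt hlt).ne'
  have htop := rateMeasure_Iic_ne_top R t'
  refine (rho_le_mul_div R htt'.le h0).trans_lt ?_
  conv_rhs => rw [← mul_one (rho R t')]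
  refine ENNReal.mul_lt_mul_right (rho_pos hα hβ (zero_le.trans_lt htt')).ne'
    (rho_lt_top R t').ne ?_
  rw [ENNReal.div_lt_iff (Or.inl h0) (Or.inl htop), one_mul]
  exact hlt

lemma continuous_rho {K : ℕ} {R : RateFunctions K} (hmono : Monotone (rho R)) :
    Continuous (rho R) := by
  have hlip : ∀ T : ℝ≥0, ∃ C, LipschitzOnWith C (fun t => (rho R t).toReal) (Iic T) := fun T => by
    obtain ⟨C, hC⟩ := exists_rho_le_add R T
    refine ⟨C, LipschitzOnWith.of_le_add_mul C fun x hx y hy => ?_⟩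
    rcases le_total x y with hxy | hyx
    · have := ENNReal.toReal_mono (rho_lt_top R y).ne (hmono hxy)
      have h2 : 0 ≤ (C : ℝ) * dist x y := by positivity
      linarith
    · have hfin : (C : ℝ≥0∞) * ((x - y : ℝ≥0) : ℝ≥0∞) ≠ ∞ :=
        ENNReal.mul_ne_top ENNReal.coe_ne_top ENNReal.coe_ne_top
      have := ENNReal.toReal_mono (ENNReal.add_ne_top.2 ⟨(rho_lt_top R y).ne, hfin⟩) (hC y x hyx hx)
      rw [ENNReal.toReal_add (rho_lt_top R y).ne hfin, ENNReal.toReal_mul, ENNReal.coe_toReal,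
        ENNReal.coe_toReal, NNReal.coe_sub hyx] at this
      refine this.trans_eq ?_
      rw [NNReal.dist_eq, abs_of_nonneg (sub_nonneg.2 (NNReal.coe_le_coe.2 hyx))]
  have hcont : Continuous fun t => (rho R t).toReal := continuous_iff_continuousAt.2 fun t => by
    obtain ⟨C, hC⟩ := hlip (t + 1)
    exact hC.continuousOn.continuousAt (Iic_mem_nhds (lt_add_one t))
  have heq : rho R = fun t => ENNReal.ofReal (rho R t).toReal :=
    funext fun t => (ENNReal.ofReal_toReal (rho_lt_top R t).ne).symm
  rw [heq]
  exact ENNReal.continuous_ofReal.comp hcont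

lemma tendsto_rateMeasure_Iic {K : ℕ} {R : RateFunctions K} (h : 0 < liminf R.β atTop) :
    Tendsto (fun t => rateMeasure R (Iic t)) atTop (𝓝 ∞) := by
  obtain ⟨c, hc0, hc⟩ := exists_between h
  have hev : ∀ᶠ u in atTop, c < R.β u := eventually_lt_of_lt_liminf hc
  obtain ⟨a, ha⟩ := eventually_atTop.1 hev
  have hlim : Tendsto (fun t : ℝ≥0 => ((c * (t - a) : ℝ≥0) : ℝ≥0∞)) atTop (𝓝 ∞) := by
    refine ENNReal.tendsto_coe_nhds_top.2 (tendsto_atTop.2 fun b => ?_)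
    filter_upwards [eventually_ge_atTop (a + b / c)] with t ht
    have : b / c ≤ t - a := le_tsub_of_add_le_left ht
    rwa [div_le_iff₀ hc0, mul_comm] at this
  refine tendsto_nhds_top_mono hlim (Eventually.of_forall fun t => ?_)
  refine le_trans ?_ (measure_mono (Ioc_subset_Iic_self (a := a)))
  simp only
  rw [rateMeasure, withDensity_apply _ measurableSet_Ioc, ENNReal.coe_mul, ← leb_Ioc,
    ← setLIntegral_const]
  refine setLIntegral_mono' measurableSet_Ioc fun u hu => ?_
  exact ENNReal.coe_le_coe.2 (ha u hu.1.le).le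

lemma tendsto_rho {K : ℕ} {R : RateFunctions K}
    (hα : ∀ t : ℝ≥0, 0 < t → ∃ i, ∃ s ≤ t, 0 < R.α i s)
    (hβ : ∀ t : ℝ≥0, 0 < t → 0 < R.β t) (hβ_liminf : 0 < liminf R.β atTop) :
    Tendsto (rho R) atTop (𝓝 ∞) := by
  have hB1 := rateMeasure_Iic_ne_top R 1
  have hB1' : ∀ t : ℝ≥0, 0 < t → rateMeasure R (Iic t) ≠ 0 := fun t ht =>
    (zero_le.trans_lt (rateMeasure_Iic_lt hβ ht)).ne'
  have hd : rho R 1 / rateMeasure R (Iic 1) ≠ 0 :=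
    ENNReal.div_ne_zero.2 ⟨(rho_pos hα hβ one_pos).ne', hB1⟩
  have hlim := ENNReal.Tendsto.const_mul (a := rho R 1 / rateMeasure R (Iic 1))
    (tendsto_rateMeasure_Iic hβ_liminf) (Or.inl ENNReal.top_ne_zero)
  rw [ENNReal.mul_top hd] at hlim
  refine tendsto_nhds_top_mono hlim ?_
  filter_upwards [eventually_ge_atTop 1] with t ht
  have ht0 := hB1' t (one_pos.trans_le ht)
  have httop := rateMeasure_Iic_ne_top R t
  have h1 := rho_le_mul_div R ht ht0
  calc rho R 1 / rateMeasure R (Iic 1) * rateMeasure R (Iic t)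
      ≤ rho R t * (rateMeasure R (Iic 1) / rateMeasure R (Iic t)) / rateMeasure R (Iic 1) *
        rateMeasure R (Iic t) := by gcongr
    _ = rho R t * (rateMeasure R (Iic 1) * (rateMeasure R (Iic 1))⁻¹) *
        (rateMeasure R (Iic t) * (rateMeasure R (Iic t))⁻¹) := by
        simp only [div_eq_mul_inv]
        ring
    _ = rho R t := by
        rw [ENNReal.mul_inv_cancel (hB1' 1 one_pos) hB1, ENNReal.mul_inv_cancel ht0 httop, mul_one,
          mul_one]

end IRG

theorem proposition5p10 {K : ℕ} (R : IRG.RateFunctions K)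
    (hα : ∀ t : ℝ≥0, 0 < t → ∃ i, ∃ s ≤ t, 0 < R.α i s)
    (hβ : ∀ t : ℝ≥0, 0 < t → 0 < R.β t)
    (hβ_liminf : 0 < liminf R.β atTop) :
    ((∀ t, IRG.rho R t < ∞) ∧ Continuous (IRG.rho R) ∧ StrictMono (IRG.rho R) ∧
      IRG.rho R 0 = 0 ∧ Tendsto (IRG.rho R) atTop (𝓝 ∞)) ∧
    ∃! t : ℝ≥0, IRG.rho R t = 1 := by
  have hmono := IRG.strictMono_rho hα hβ
  have hcont := IRG.continuous_rho hmono.monotone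
  have hlim := IRG.tendsto_rho hα hβ hβ_liminf
  refine ⟨⟨IRG.rho_lt_top R, hcont, hmono, IRG.rho_zero R, hlim⟩, ?_⟩
  obtain ⟨T, hT⟩ := (hlim.eventually (Ici_mem_nhds ENNReal.one_lt_top)).exists
  obtain ⟨t, ht⟩ := mem_range_of_exists_le_of_exists_ge hcont
    ⟨0, (IRG.rho_zero R).trans_le zero_le⟩ ⟨T, hT⟩
  exact ⟨t, ht, fun t' ht' => hmono.injective (ht'.trans ht.symm)⟩
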